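/- Let $n\ge 3$, $N=\{1,\dots,n\}$ and $V=[0,\beta]$ with $\beta>0$. An allocation rule is a map $f:V^n\to[0,1]^n$ with $\sum_{i\in N} f_i(\mathbf v)\le 1$ for all $\mathbf v\in V^n$. It is satisfactorily implementable if there are payments $p:V^n\to\mathbb R^n$ such that, for all $\mathbf v\in V^n$: (a) $v_if_i(\mathbf v)-p_i(\mathbf v)\ge v_if_i(v_i',v_{-i})-p_i(v_i',v_{-i})$ for all $i\in N$ and $v_i'\in V$ (dominant strategy incentive compatibility); (b) $\sum_{i\in N} p_i(\mathbf v)=0$ (budget balance); (c) $f_i(\mathbf v)=f_j(\mathbf v)$ and $p_i(\mathbf v)=p_j(\mathbf v)$ whenever $v_i=v_j$ (symmetry). For $\mathbf v\in V^n$ let $\mathbf v[k]$ be the set of agents with the $k$-th highest valuation, i.e. $\mathbf v[k]$ consists of the agents of highest valuation among those outside $\mathbf v[1]\cup\dots\cup\mathbf v[k-1]$, and let $L_k=|\mathbf v[1]\cup\dots\cup\mathbf v[k]|$. A ranking allocation rule with probabilities $(\pi_1,\dots,\pi_n)$, where $1\ge\pi_1\ge\dots\ge\pi_n\ge0$ and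 $\sum_i\pi_i\le1$, is an allocation rule $f$ with $f_i(\mathbf v)=f_j(\mathbf v)$ whenever $v_i=v_j$, and with $\sum_{i\in \mathbf v[1]\cup\dots\cup\mathbf v[k]}f_i(\mathbf v)=\sum_{m=1}^{L_k}\pi_m$ for all $\mathbf v\in V^n$ and $k\in N$. A satisfactorily implementable ranking rule is r-optimal if its $\pi_1$ is at least the $\pi_1'$ of every satisfactorily implementable ranking rule. A satisfactorily implementable ranking rule $f$ is r-Pareto optimal if there is no satisfactorily implementable ranking rule $f'$ with $\sum_i v_if'_i(\mathbf v)\ge\sum_i v_if_i(\mathbf v)$ for all $\mathbf v\in V^n$ and strict inequality for some $\mathbf v$. The Green–Laffont (GL) allocation rule draws one agent uniformly at random and gives the object to a highest-valuation agent among the remaining $n-1$ agents, ties being broken uniformly. For an even integer $\ell$ with $2\le\ell\le n-1$ that minimizes $\frac{i-1}{\binom{n-2}{i-1}+i}$ over all even $i$ with $2\le i\le n-1$, let $$\pi_1^*=1-\frac{\ell-1}{\binom{n-2}{\ell-1}+\ell},\qquad \pi_k^*=\frac{1}{\binom{n-2}{\ell-1}+\ell}\ \ (2\le k\le\ell),\qquad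 \pi_k^*=0\ \ (k>\ell).$$ Then: 1. If $n\le 8$, the GL rule is the ranking rule with probabilities $(1-\frac1n,\frac1n,0,\dots,0)$, and it is the unique r-Pareto optimal ranking allocation rule. 2. If $n>8$, then for every such $\ell$ the ranking rule with probabilities $(\pi_1^*,\dots,\pi_n^*)$ exists, it is the unique r-optimal ranking allocation rule, and it is r-Pareto optimal. 3. For every $n\ge3$, every r-Pareto optimal ranking allocation rule with probabilities $(\pi_1,\dots,\pi_n)$ and every such $\ell$ satisfy $1-\frac1n\le\pi_1\le\pi_1^*$. -/

import Mathlib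

noncomputable section

namespace RankingMechanism

/-- A valuation profile: every one of the `n` agents has a valuation in `V = [0, β]`. -/
abbrev Profile (n : ℕ) (β : ℝ) : Type := Fin n → Set.Icc (0 : ℝ) β

/-- A family of real functions on profiles, one for each agent. It serves both for allocation
rules (see `IsAllocationRule`) and for payment rules. -/
abbrev Rule (n : ℕ) (β : ℝ) : Type := Profile n β → Fin n → ℝ

/-- `f` takes values in `[0,1]^n` and never allocates more than one unit in total. -/
def IsAllocationRule {n : ℕ} {β : ℝ} (f : Rule n β) : Prop :=
  (∀ v i, 0 ≤ f v i ∧ f v i ≤ 1) ∧ ∀ v, ∑ i, f v i ≤ 1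

/-- Agents with equal valuations are treated equally. -/
def IsSymmetric {n : ℕ} {β : ℝ} (f : Rule n β) : Prop :=
  ∀ v i j, v i = v j → f v i = f v j

/-- Dominant strategy incentive compatibility: truth-telling is optimal for agent `i` whatever the
reports of the other agents are. -/
def IsDSIC {n : ℕ} {β : ℝ} (f p : Rule n β) : Prop :=
  ∀ (i : Fin n) (v : Profile n β) (x : Set.Icc (0 : ℝ) β),
    (v i : ℝ) * f (Function.update v i x) i - p (Function.update v i x) i
      ≤ (v i : ℝ) * f v i - p v i

/-- Payments add up to zero at every profile. -/
def IsBudgetBalanced {n : ℕ} {β : ℝ} (p : Rule n β) : Prop :=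
  ∀ v, ∑ i, p v i = 0

/-- A satisfactory mechanism: DSIC, budget-balanced and symmetric (in allocation and payments). -/
def IsSatisfactory {n : ℕ} {β : ℝ} (f p : Rule n β) : Prop :=
  IsDSIC f p ∧ IsBudgetBalanced p ∧ IsSymmetric f ∧ IsSymmetric p

/-- Satisfactory implementability of an allocation rule. -/
def IsSatisfactorilyImplementable {n : ℕ} {β : ℝ} (f : Rule n β) : Prop :=
  ∃ p : Rule n β, IsSatisfactory f p

/-- The agents in `S` whose valuation is highest among the agents in `S`. -/
def highest {n : ℕ} {β : ℝ} (v : Profile n β) (S : Finset (Fin n)) : Finset (Fin n) :=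
  S.filter fun i => ∀ j ∈ S, v j ≤ v i

/-- `topAgents v k = v[1] ∪ ... ∪ v[k]`, where `v[k]` is the set of agents with the `k`-th highest
valuation, i.e. those with the highest valuation outside `v[1] ∪ ... ∪ v[k-1]`. -/
def topAgents {n : ℕ} {β : ℝ} (v : Profile n β) : ℕ → Finset (Fin n)
  | 0 => ∅
  | k + 1 => topAgents v k ∪ highest v (topAgents v k)ᶜ

/-- Rank probabilities `π 1 ≥ ... ≥ π n` in `[0,1]` with sum at most one. Ranks are numbered from
`1`; values of `π` outside `1, ..., n` play no role. -/
def IsRankProbabilities (n : ℕ) (π : ℕ → ℝ) : Prop :=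
  (∀ k ∈ Finset.Icc 1 n, 0 ≤ π k ∧ π k ≤ 1) ∧
  (∀ k ∈ Finset.Icc 1 n, ∀ l ∈ Finset.Icc 1 n, k ≤ l → π l ≤ π k) ∧
  ∑ k ∈ Finset.Icc 1 n, π k ≤ 1

/-- `f` is the ranking allocation rule with probabilities `π 1, ..., π n`: it is a symmetric
allocation rule and, for every `k`, the agents in `v[1] ∪ ... ∪ v[k]`, who occupy the ranks
`1, ..., |v[1] ∪ ... ∪ v[k]|`, receive together the probabilities of these ranks. -/
def IsRankingRuleWith {n : ℕ} {β : ℝ} (f : Rule n β) (π : ℕ → ℝ) : Prop :=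
  IsAllocationRule f ∧ IsSymmetric f ∧ IsRankProbabilities n π ∧
  ∀ v, ∀ k ∈ Finset.Icc 1 n,
    ∑ i ∈ topAgents v k, f v i = ∑ m ∈ Finset.Icc 1 (topAgents v k).card, π m

/-- Ranking allocation rules. -/
def IsRankingRule {n : ℕ} {β : ℝ} (f : Rule n β) : Prop :=
  ∃ π : ℕ → ℝ, IsRankingRuleWith f π

/-- A ranking rule is r-optimal if it is satisfactorily implementable and its top-rank probability
is at least that of any satisfactorily implementable ranking rule. -/
def IsROptimal {n : ℕ} {β : ℝ} (f : Rule n β) : Prop :=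
  ∃ π : ℕ → ℝ, IsRankingRuleWith f π ∧ IsSatisfactorilyImplementable f ∧
    ∀ (g : Rule n β) (ρ : ℕ → ℝ), IsRankingRuleWith g ρ → IsSatisfactorilyImplementable g →
      ρ 1 ≤ π 1

/-- Total welfare of `f` at the profile `v` (payments cancel under budget balance). -/
def welfare {n : ℕ} {β : ℝ} (f : Rule n β) (v : Profile n β) : ℝ :=
  ∑ i, (v i : ℝ) * f v i

/-- A ranking rule is r-Pareto optimal if it is satisfactorily implementable and no satisfactorily
implementable ranking rule yields at least its welfare at all profiles and more at some profile. -/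
def IsRParetoOptimal {n : ℕ} {β : ℝ} (f : Rule n β) : Prop :=
  IsRankingRule f ∧ IsSatisfactorilyImplementable f ∧
    ¬ ∃ g : Rule n β, IsRankingRule g ∧ IsSatisfactorilyImplementable g ∧
      (∀ v, welfare f v ≤ welfare g v) ∧ ∃ v, welfare f v < welfare g v

/-- The allocation rule of the Green–Laffont mechanism: an agent `k` is drawn uniformly at random
and the object is given to a highest-valuation agent among the others (Vickrey auction, with ties
broken uniformly). -/
def greenLaffont (n : ℕ) (β : ℝ) : Rule n β := fun v i =>
  (1 / (n : ℝ)) * ∑ k : Fin n,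
    if i ∈ highest v (Finset.univ.erase k) then
      1 / ((highest v (Finset.univ.erase k)).card : ℝ) else 0

/-- The rank probabilities `(1 - 1/n, 1/n, 0, ..., 0)`. -/
def greenLaffontProb (n : ℕ) (k : ℕ) : ℝ :=
  if k = 1 then 1 - 1 / (n : ℝ) else if k = 2 then 1 / (n : ℝ) else 0

/-- The rank probabilities `π*` of the two-step ranking rule with parameter `ℓ`. -/
def twoStepProb (n ℓ : ℕ) (k : ℕ) : ℝ :=
  if k = 1 then 1 - ((ℓ : ℝ) - 1) / ((Nat.choose (n - 2) (ℓ - 1) : ℝ) + ℓ)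
  else if 2 ≤ k ∧ k ≤ ℓ then 1 / ((Nat.choose (n - 2) (ℓ - 1) : ℝ) + ℓ)
  else 0

/-- `ℓ` minimizes `(i - 1) / (C(n-2, i-1) + i)` over the even numbers `i` with `2 ≤ i ≤ n - 1`. -/
def IsOptimalStep (n ℓ : ℕ) : Prop :=
  (2 ≤ ℓ ∧ ℓ + 1 ≤ n ∧ Even ℓ) ∧
  ∀ i : ℕ, 2 ≤ i → i + 1 ≤ n → Even i →
    ((ℓ : ℝ) - 1) / ((Nat.choose (n - 2) (ℓ - 1) : ℝ) + ℓ)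
      ≤ ((i : ℝ) - 1) / ((Nat.choose (n - 2) (i - 1) : ℝ) + i)

end RankingMechanism

end

namespace RankingMechanism

open Finset

variable {n : ℕ} {β : ℝ}

/-! Write `Π_J` for the sum of the first `J` rank probabilities, `m = n - 2`, and `d_j ≥ 0` for the
drop of the probabilities after rank `j + 1`.

A ranking rule gives every upper set of `J` agents total probability `Π_J`. Slicing valuations at
thresholds `t` therefore turns welfare into `∫ Π_{J(t)} dt`, where `J(t)` counts the valuations at
least `t`. So one ranking rule is at least as good as another at all profiles exactly when its
partial sums are at least as large.

Implementability is one linear equation, `budgetDefect n π = 0`. It suffices because Myerson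
payments plus rebates `∫ A (J_{-i}(t)) dt` balance the budget threshold by threshold once `A` solves
a recursion whose last equation is this one. It is necessary because the alternating sum of the
payments over the profiles with values in `{0, β}` gives it. Summation by parts turns it into `∑
(-1)^j C(m,j) d_j = 0`.

Maximizing `π 1 = ∑ d_j` subject to this and to `∑ (j+1) d_j ≤ 1` is a linear programme. Weighting
the two constraints by `θ` and `1 - θ` gives `π 1 ≤ 1 - θ`, with `θ` the minimum of `j / (C(m,j) + j
+ 1)` over odd `j ≤ m`. If the minimum is attained only once, complementary slackness makes the
optimum unique. This is so for `m ≥ 7`: `(C(m,j) + 1) / j` never rises again, along odd `j`, once it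
has failed to rise.

For `n ≤ 8` the minimum is `1/n` (at `n = 8` both `j = 1` and `j = 3` attain it). The Green–Laffont
partial sums `1 - 1/n, 1, 1, ...` are then the largest possible at every `J`, so its rule dominates
whatever the ties. -/

/-! ### Ranking rules and upper sets of agents -/

/-- A set of agents closed under passing to agents with weakly higher valuations. -/
def IsUpperAt (v : Profile n β) (U : Finset (Fin n)) : Prop :=
  ∀ j ∈ U, ∀ i, v j ≤ v i → i ∈ U

/-- The agents with a strictly higher valuation than `i`. -/
noncomputable def above (v : Profile n β) (i : Fin n) : Finset (Fin n) := univ.filter fun j => v i < v j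

/-- The agents with the same valuation as `i`. -/
noncomputable def tied (v : Profile n β) (i : Fin n) : Finset (Fin n) := univ.filter fun j => v j = v i

/-- The partial sums of a sequence of rank probabilities. -/
noncomputable def partialSum (π : ℕ → ℝ) (j : ℕ) : ℝ := ∑ m ∈ Icc 1 j, π m

theorem partialSum_zero (π : ℕ → ℝ) : partialSum π 0 = 0 := by simp [partialSum]

theorem partialSum_succ (π : ℕ → ℝ) (j : ℕ) :
    partialSum π (j + 1) = partialSum π j + π (j + 1) := by
  simp [partialSum, sum_Icc_succ_top]

theorem partialSum_one (π : ℕ → ℝ) : partialSum π 1 = π 1 := by simp [partialSum]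

theorem partialSum_add (π : ℕ → ℝ) (a b : ℕ) :
    partialSum π (a + b) = partialSum π a + ∑ m ∈ Ioc a (a + b), π m := by
  induction b with
  | zero => simp
  | succ b ih =>
    rw [← add_assoc, partialSum_succ, ih, sum_Ioc_succ_top (by omega), add_assoc]

theorem highest_nonempty (v : Profile n β) {S : Finset (Fin n)} (hS : S.Nonempty) :
    (highest v S).Nonempty := by
  obtain ⟨i, hi, h⟩ := S.exists_max_image v hS
  exact ⟨i, by simp [highest, hi]; exact h⟩

theorem isUpperAt_topAgents (v : Profile n β) (k : ℕ) : IsUpperAt v (topAgents v k) := by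
  induction k with
  | zero => intro j hj; simp [topAgents] at hj
  | succ k ih =>
    intro j hj i hij
    rw [topAgents, mem_union] at hj ⊢
    rcases hj with hj | hj
    · exact Or.inl (ih j hj i hij)
    · by_cases hi : i ∈ topAgents v k
      · exact Or.inl hi
      · simp only [highest, mem_filter] at hj ⊢
        exact Or.inr ⟨by simpa using hi, fun l hl => (hj.2 l hl).trans hij⟩

theorem min_le_card_topAgents (v : Profile n β) (k : ℕ) : min k n ≤ #(topAgents v k) := by
  induction k with
  | zero => simp
  | succ k ih =>
    rw [topAgents]
    by_cases h : (topAgents v k)ᶜ.Nonempty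
    · obtain ⟨i, hi⟩ := highest_nonempty v h
      have h1 : i ∉ topAgents v k := by
        have := (mem_filter.1 hi).1
        simpa using this
      have h2 : insert i (topAgents v k) ⊆ topAgents v k ∪ highest v (topAgents v k)ᶜ := by
        intro j hj
        rcases mem_insert.1 hj with rfl | hj
        · exact mem_union_right _ hi
        · exact mem_union_left _ hj
      have h3 := card_le_card h2
      rw [card_insert_of_notMem h1] at h3
      omega
    · have h1 : topAgents v k = univ := by simpa using h
      rw [h1]
      have := card_le_card (subset_union_left (s₁ := univ) (s₂ := highest v univᶜ))
      rw [card_univ, Fintype.card_fin] at this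
      omega

theorem topAgents_self (v : Profile n β) : topAgents v n = univ := by
  rw [← card_eq_iff_eq_univ, Fintype.card_fin]
  refine le_antisymm ?_ (by simpa using min_le_card_topAgents v n)
  simpa using card_le_univ (topAgents v n)

/-- Take the first stage that covers `U`. Some `u ∈ U` was missing one stage earlier, so everyone in
the new stage has a valuation at least that of `u` and lies in the upper set `U`. This frees the
rest of the proof from the recursion in `topAgents`. -/
theorem exists_topAgents_eq (v : Profile n β) {U : Finset (Fin n)} (hU : IsUpperAt v U)
    (hne : U.Nonempty) : ∃ k ∈ Icc 1 n, topAgents v k = U := by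
  classical
  have hex : ∃ k, U ⊆ topAgents v k := ⟨n, by simp [topAgents_self]⟩
  have hle : Nat.find hex ≤ n := Nat.find_min' hex (by simp [topAgents_self])
  obtain ⟨k, hk⟩ : ∃ k, Nat.find hex = k + 1 := by
    refine Nat.exists_eq_succ_of_ne_zero fun h0 => ?_
    have h := Nat.find_spec hex
    rw [h0, topAgents] at h
    exact hne.ne_empty (subset_empty.1 h)
  have hsub := Nat.find_spec hex
  rw [hk] at hsub
  have hnot : ¬ U ⊆ topAgents v k := Nat.find_min hex (by omega)
  obtain ⟨u, huU, huT⟩ := not_subset.1 hnot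
  refine ⟨k + 1, by simp; omega, subset_antisymm ?_ hsub⟩
  intro x hx
  rw [topAgents, mem_union] at hx
  rcases hx with hx | hx
  · refine hU u huU x (le_of_lt (not_le.1 fun h => huT ?_))
    exact isUpperAt_topAgents v k x hx u h
  · exact hU u huU x ((mem_filter.1 hx).2 u (by simpa using huT))

theorem IsRankingRuleWith.sum_upper {f : Rule n β} {π : ℕ → ℝ} (h : IsRankingRuleWith f π)
    {v : Profile n β} {U : Finset (Fin n)} (hU : IsUpperAt v U) :
    ∑ i ∈ U, f v i = partialSum π #U := by
  rcases U.eq_empty_or_nonempty with rfl | hne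
  · simp [partialSum]
  · obtain ⟨k, hk, rfl⟩ := exists_topAgents_eq v hU hne
    exact h.2.2.2 v k hk

theorem isUpperAt_above (v : Profile n β) (i : Fin n) : IsUpperAt v (above v i) := by
  intro j hj l hl
  simp only [above, mem_filter, mem_univ, true_and] at *
  exact hj.trans_le hl

theorem isUpperAt_above_union_tied (v : Profile n β) (i : Fin n) :
    IsUpperAt v (above v i ∪ tied v i) := by
  intro j hj l hl
  simp only [above, tied, mem_union, mem_filter, mem_univ, true_and] at *
  rcases hj with hj | hj
  · exact Or.inl (hj.trans_le hl)
  · rw [hj] at hl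
    exact hl.lt_or_eq.imp_right Eq.symm

theorem disjoint_above_tied (v : Profile n β) (i : Fin n) : Disjoint (above v i) (tied v i) := by
  rw [disjoint_left]
  intro j hj hj'
  simp only [above, tied, mem_filter, mem_univ, true_and] at *
  exact hj.ne hj'.symm

theorem self_mem_tied (v : Profile n β) (i : Fin n) : i ∈ tied v i := by simp [tied]

theorem card_tied_pos (v : Profile n β) (i : Fin n) : 0 < #(tied v i) :=
  card_pos.2 ⟨i, self_mem_tied v i⟩

theorem card_above_add_card_tied (v : Profile n β) (i : Fin n) :
    #(above v i) + #(tied v i) = #(above v i ∪ tied v i) :=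
  (card_union_of_disjoint (disjoint_above_tied v i)).symm

theorem card_above_add_card_tied_le (v : Profile n β) (i : Fin n) :
    #(above v i) + #(tied v i) ≤ n := by
  rw [card_above_add_card_tied]
  simpa using card_le_univ (above v i ∪ tied v i)

/-- Tied agents share the probabilities of the ranks that they occupy. -/
theorem IsRankingRuleWith.card_tied_mul {f : Rule n β} {π : ℕ → ℝ} (h : IsRankingRuleWith f π)
    (v : Profile n β) (i : Fin n) :
    #(tied v i) * f v i =
      partialSum π (#(above v i) + #(tied v i)) - partialSum π #(above v i) := by
  have h1 := h.sum_upper (isUpperAt_above_union_tied v i)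
  rw [sum_union (disjoint_above_tied v i), h.sum_upper (isUpperAt_above v i),
    ← card_above_add_card_tied] at h1
  have h2 : ∑ j ∈ tied v i, f v j = #(tied v i) * f v i := by
    rw [sum_congr rfl fun j hj => h.2.1 v j i (by simpa [tied] using hj)]
    simp
  linarith

theorem IsRankingRuleWith.eq_of_partialSum_eq {f g : Rule n β} {π ρ : ℕ → ℝ}
    (hf : IsRankingRuleWith f π) (hg : IsRankingRuleWith g ρ)
    (h : ∀ j ≤ n, partialSum π j = partialSum ρ j) : f = g := by
  funext v i
  have h1 := hf.card_tied_mul v i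
  have h2 := hg.card_tied_mul v i
  have h3 := card_above_add_card_tied_le v i
  rw [h _ h3, h _ (by omega), ← h2] at h1
  exact mul_left_cancel₀ (by exact_mod_cast (card_tied_pos v i).ne') h1

/-- The ranking rule in which tied agents share the probabilities of the ranks they occupy. -/
noncomputable def tieAverage (n : ℕ) (β : ℝ) (π : ℕ → ℝ) : Rule n β := fun v i =>
  (partialSum π (#(above v i) + #(tied v i)) - partialSum π #(above v i)) / #(tied v i)

theorem isSymmetric_tieAverage (π : ℕ → ℝ) : IsSymmetric (tieAverage n β π) := by
  intro v i j hij
  simp only [tieAverage, above, tied, hij]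

theorem sum_upper_tieAverage (π : ℕ → ℝ) (v : Profile n β) (U : Finset (Fin n))
    (hU : IsUpperAt v U) : ∑ i ∈ U, tieAverage n β π v i = partialSum π #U := by
  induction U using Finset.strongInduction with
  | H U ih =>
    rcases U.eq_empty_or_nonempty with rfl | hne
    · simp [partialSum]
    -- Peel off the lowest tie class of `U`; what remains is again an upper set.
    obtain ⟨i, hi, hmin⟩ := U.exists_min_image v hne
    have hUeq : U = above v i ∪ tied v i := by
      ext j
      simp only [above, tied, mem_union, mem_filter, mem_univ, true_and]
      constructor
      · intro hj
        exact (hmin j hj).lt_or_eq.imp_right Eq.symm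
      · rintro (hj | hj)
        · exact hU i hi j hj.le
        · exact hU i hi j hj.ge
    have hss : above v i ⊂ U := by
      rw [ssubset_iff_of_subset (by rw [hUeq]; exact subset_union_left)]
      exact ⟨i, hi, by simp [above]⟩
    have h1 := ih _ hss (isUpperAt_above v i)
    have h2 : ∑ j ∈ tied v i, tieAverage n β π v j = #(tied v i) * tieAverage n β π v i := by
      rw [sum_congr rfl fun j hj => isSymmetric_tieAverage π v j i (by simpa [tied] using hj)]
      simp
    have h3 : (#(tied v i) : ℝ) ≠ 0 := by exact_mod_cast (card_tied_pos v i).ne'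
    rw [hUeq, sum_union (disjoint_above_tied v i), h1, h2, ← card_above_add_card_tied, tieAverage,
      mul_div_cancel₀ _ h3]
    ring

theorem isRankingRuleWith_of_sum_upper {f : Rule n β} {π : ℕ → ℝ} (hπ : IsRankProbabilities n π)
    (h0 : ∀ v i, 0 ≤ f v i) (hs : IsSymmetric f)
    (h : ∀ v U, IsUpperAt v U → ∑ i ∈ U, f v i = partialSum π #U) : IsRankingRuleWith f π := by
  have hle : ∀ v, ∑ i, f v i ≤ 1 := fun v => by
    rw [h v univ fun _ _ _ _ => mem_univ _]
    simpa [partialSum] using hπ.2.2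
  refine ⟨⟨fun v i => ⟨h0 v i, ?_⟩, hle⟩, hs, hπ, fun v k _ => h v _ (isUpperAt_topAgents v k)⟩
  exact (single_le_sum (f := f v) (fun j _ => h0 v j) (mem_univ i)).trans (hle v)

theorem isRankingRuleWith_tieAverage {π : ℕ → ℝ} (hπ : IsRankProbabilities n π) :
    IsRankingRuleWith (tieAverage n β π) π := by
  refine isRankingRuleWith_of_sum_upper hπ (fun v i => ?_) (isSymmetric_tieAverage π)
    (sum_upper_tieAverage π)
  have h := card_above_add_card_tied_le v i
  refine div_nonneg ?_ (Nat.cast_nonneg _)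
  rw [partialSum_add, add_sub_cancel_left]
  exact sum_nonneg fun m hm => (hπ.1 m (by simp at hm ⊢; omega)).1

/-! ### Integration over valuation thresholds -/

open MeasureTheory

/-- The number of agents in `S` whose valuation is at least `t`. -/
noncomputable def countGE (v : Profile n β) (S : Finset (Fin n)) (t : ℝ) : ℕ :=
  #(S.filter fun j => t ≤ v j)

theorem countGE_antitone (v : Profile n β) (S : Finset (Fin n)) : Antitone (countGE v S) :=
  fun _ _ h => card_le_card (monotone_filter_right S fun _ _ hj => h.trans hj)

theorem countGE_le (v : Profile n β) (S : Finset (Fin n)) (t : ℝ) : countGE v S t ≤ n := by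
  simpa [countGE] using card_le_univ (S.filter fun j => t ≤ (v j : ℝ))

theorem measurable_comp_countGE (v : Profile n β) (S : Finset (Fin n)) (F : ℕ → ℝ) :
    Measurable fun t => F (countGE v S t) :=
  (measurable_from_top (f := F)).comp (countGE_antitone v S).measurable

theorem exists_abs_le_comp_countGE (v : Profile n β) (S : Finset (Fin n)) (F : ℕ → ℝ) :
    ∃ C, ∀ t, |F (countGE v S t)| ≤ C :=
  ⟨∑ j ∈ range (n + 1), |F j|, fun t =>
    single_le_sum (f := fun j => |F j|) (fun _ _ => abs_nonneg _)
      (mem_range.2 (Nat.lt_succ_of_le (countGE_le v S t)))⟩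

theorem intervalIntegrable_of_measurable_of_bounded {g : ℝ → ℝ} (hg : Measurable g)
    (h : ∃ C, ∀ t, |g t| ≤ C) (a b : ℝ) : IntervalIntegrable g volume a b := by
  obtain ⟨C, hC⟩ := h
  refine (intervalIntegrable_const (c := C)).mono_fun hg.aestronglyMeasurable (ae_of_all _ fun t => ?_)
  simp only [Real.norm_eq_abs]
  exact (hC t).trans (le_abs_self C)

theorem intervalIntegrable_comp_countGE (v : Profile n β) (S : Finset (Fin n)) (F : ℕ → ℝ)
    (a b : ℝ) : IntervalIntegrable (fun t => F (countGE v S t)) volume a b :=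
  intervalIntegrable_of_measurable_of_bounded (measurable_comp_countGE v S F)
    (exists_abs_le_comp_countGE v S F) a b

theorem intervalIntegrable_ite_comp_countGE (v : Profile n β) (S : Finset (Fin n)) (F : ℕ → ℝ)
    (x a b : ℝ) :
    IntervalIntegrable (fun t => if t ≤ x then F (countGE v S t) else 0) volume a b := by
  refine intervalIntegrable_of_measurable_of_bounded
    (Measurable.ite measurableSet_Iic (measurable_comp_countGE v S F) measurable_const) ?_ a b
  obtain ⟨C, hC⟩ := exists_abs_le_comp_countGE v S F
  refine ⟨C, fun t => ?_⟩
  split_ifs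
  · exact hC t
  · simpa using (abs_nonneg _).trans (hC t)

theorem integral_ite_le {x : ℝ} (hx : x ∈ Set.Icc 0 β) (g : ℝ → ℝ) :
    ∫ t in (0 : ℝ)..β, (if t ≤ x then g t else 0) = ∫ t in (0 : ℝ)..x, g t :=
  intervalIntegral.integral_indicator (f := g) hx

theorem isUpperAt_filter_le (v : Profile n β) (t : ℝ) :
    IsUpperAt v (univ.filter fun j => t ≤ v j) := by
  intro j hj i hij
  simp only [mem_filter, mem_univ, true_and] at *
  exact hj.trans hij

/-- The agents with valuation at least `t` occupy the first ranks. -/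
theorem IsRankingRuleWith.sum_ite_le {f : Rule n β} {π : ℕ → ℝ} (h : IsRankingRuleWith f π)
    (v : Profile n β) (t : ℝ) :
    ∑ i, (if t ≤ v i then f v i else 0) = partialSum π (countGE v univ t) := by
  rw [← sum_filter]
  exact h.sum_upper (isUpperAt_filter_le v t)

/-- Layer-cake formula: `v i` is the length of the set of thresholds `t ≤ v i`, and at each `t` the
agents above it form an upper set. -/
theorem IsRankingRuleWith.welfare_eq_integral {f : Rule n β} {π : ℕ → ℝ}
    (h : IsRankingRuleWith f π) (v : Profile n β) :
    welfare f v = ∫ t in (0 : ℝ)..β, partialSum π (countGE v univ t) := by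
  have h1 : ∀ i, (v i : ℝ) * f v i = ∫ t in (0 : ℝ)..β, if t ≤ v i then f v i else 0 := by
    intro i
    rw [integral_ite_le (v i).2 fun _ => f v i]
    simp
  rw [welfare, sum_congr rfl fun i _ => h1 i, ← intervalIntegral.integral_finsetSum]
  · simp_rw [h.sum_ite_le v]
  · intro i _
    exact intervalIntegrable_ite_comp_countGE v univ (fun _ => f v i) (v i) 0 β

/-! ### Incentive compatible payments and the budget at each threshold -/

/-- Payments that make the ranking rule `f` with probabilities `π` incentive compatible: a
Myerson term and a rebate, determined by `A`, that depends only on the others' valuations. -/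
noncomputable def rankingPayment (f : Rule n β) (π A : ℕ → ℝ) : Rule n β := fun v i =>
  v i * f v i - (∫ t in (0 : ℝ)..v i, π (1 + countGE v (univ.erase i) t)) +
    ∫ t in (0 : ℝ)..β, A (countGE v (univ.erase i) t)

theorem countGE_univ_of_le {v : Profile n β} {i : Fin n} {t : ℝ} (h : t ≤ v i) :
    countGE v univ t = 1 + countGE v (univ.erase i) t := by
  rw [countGE, countGE, filter_erase, card_erase_of_mem (by simpa using h)]
  have : 0 < #(univ.filter fun j => t ≤ (v j : ℝ)) := card_pos.2 ⟨i, by simpa using h⟩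
  omega

theorem countGE_univ_of_lt {v : Profile n β} {i : Fin n} {t : ℝ} (h : v i < t) :
    countGE v univ t = countGE v (univ.erase i) t := by
  rw [countGE, countGE, filter_erase, erase_eq_of_notMem (by simpa using h)]

theorem sum_eq_of_countGE (v : Profile n β) (t : ℝ) (F G : ℕ → ℝ) :
    ∑ i, (if t ≤ v i then F (countGE v (univ.erase i) t) else G (countGE v (univ.erase i) t)) =
      countGE v univ t * F (countGE v univ t - 1) +
        (n - countGE v univ t) * G (countGE v univ t) := by
  rw [sum_ite]
  congr 1
  · rw [sum_congr rfl (g := fun _ => F (countGE v univ t - 1))]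
    · simp [countGE]
    · intro i hi
      rw [countGE_univ_of_le (by simpa using hi), Nat.add_sub_cancel_left]
  · rw [sum_congr rfl (g := fun _ => G (countGE v univ t))]
    · have := card_filter_add_card_filter_not (s := (univ : Finset (Fin n)))
        (fun j => t ≤ (v j : ℝ))
      rw [card_univ, Fintype.card_fin] at this
      have h2 : ((#(univ.filter fun j => t ≤ (v j : ℝ)) : ℝ) +
        #(univ.filter fun j => ¬ t ≤ (v j : ℝ))) = n := by exact_mod_cast this
      rw [sum_const, nsmul_eq_mul, countGE, ← h2]
      ring
    · intro i hi
      rw [countGE_univ_of_lt (by simpa using hi)]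

/-- Condition on the rebates that amounts to budget balance. -/
theorem IsRankingRuleWith.isBudgetBalanced_rankingPayment {f : Rule n β} {π A : ℕ → ℝ}
    (h : IsRankingRuleWith f π)
    (hA : ∀ J ≤ n, partialSum π J - J * π J + J * A (J - 1) + (n - J) * A J = 0) :
    IsBudgetBalanced (rankingPayment f π A) := by
  intro v
  have h1 : ∀ i, rankingPayment f π A v i = v i * f v i +
      ∫ t in (0 : ℝ)..β, if t ≤ v i then
        A (countGE v (univ.erase i) t) - π (1 + countGE v (univ.erase i) t)
      else A (countGE v (univ.erase i) t) := by
    intro i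
    rw [rankingPayment, ← integral_ite_le (v i).2, sub_add, ← intervalIntegral.integral_sub,
      sub_eq_add_neg, ← intervalIntegral.integral_neg]
    · congr 2
      funext t
      split_ifs <;> ring
    · exact intervalIntegrable_ite_comp_countGE v (univ.erase i) (fun m => π (1 + m)) _ _ _
    · exact intervalIntegrable_comp_countGE _ _ _ _ _
  have hint : ∀ i, IntervalIntegrable (fun t => if t ≤ (v i : ℝ) then
        A (countGE v (univ.erase i) t) - π (1 + countGE v (univ.erase i) t)
      else A (countGE v (univ.erase i) t)) volume 0 β := by
    intro i
    have h2 := (intervalIntegrable_comp_countGE v (univ.erase i) A 0 β).sub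
      (intervalIntegrable_ite_comp_countGE v (univ.erase i) (fun m => π (1 + m)) (v i) 0 β)
    refine h2.congr (fun t _ => ?_)
    split_ifs <;> ring
  rw [sum_congr rfl fun i _ => h1 i, sum_add_distrib, ← intervalIntegral.integral_finsetSum
    fun i _ => hint i]
  have h3 := h.welfare_eq_integral v
  rw [welfare] at h3
  rw [h3, ← intervalIntegral.integral_add
    (intervalIntegrable_comp_countGE v univ (partialSum π) 0 β)]
  · refine (intervalIntegral.integral_congr (g := fun _ => (0 : ℝ)) fun t _ => ?_).trans (by simp)
    simp only
    rw [sum_eq_of_countGE v t (fun m => A m - π (1 + m)) A]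
    have h4 := hA _ (countGE_le v univ t)
    -- At count `0` the truncated `0 - 1` is harmless, being multiplied by `0`.
    rcases Nat.eq_zero_or_pos (countGE v univ t) with h0 | h0
    · rw [h0] at h4 ⊢
      simpa using h4
    · rw [Nat.add_sub_cancel' h0]
      linarith
  · have := IntervalIntegrable.sum univ fun i (_ : i ∈ univ) => hint i
    refine this.congr (fun t _ => ?_)
    simp

/-- An agent's probability is the average over the ranks of its tie class, and none of them is worse
than the last rank among the valuations at least `t`. With `le_of_lt` this puts `f` on the right
side of the Myerson integrand even at ties. -/
theorem IsRankingRuleWith.le_of_le {f : Rule n β} {π : ℕ → ℝ} (h : IsRankingRuleWith f π)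
    (v : Profile n β) (i : Fin n) {t : ℝ} (ht : t ≤ v i) :
    π (1 + countGE v (univ.erase i) t) ≤ f v i := by
  have h1 := h.card_tied_mul v i
  have h2 := card_above_add_card_tied_le v i
  have h3 : #(above v i) + #(tied v i) ≤ 1 + countGE v (univ.erase i) t := by
    rw [← countGE_univ_of_le ht, card_above_add_card_tied, countGE]
    refine card_le_card fun j hj => ?_
    simp only [above, tied, mem_union, mem_filter, mem_univ, true_and] at *
    rcases hj with hj | hj
    · exact ht.trans (Subtype.coe_lt_coe.2 hj).le
    · rwa [hj]
  have h4 : 1 + countGE v (univ.erase i) t ≤ n := by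
    rw [← countGE_univ_of_le ht]; exact countGE_le v univ t
  rw [partialSum_add, add_sub_cancel_left] at h1
  have h5 := card_nsmul_le_sum (Ioc #(above v i) (#(above v i) + #(tied v i))) π
    (π (1 + countGE v (univ.erase i) t)) fun m hm => by
      rw [mem_Ioc] at hm
      exact h.2.2.1.2.1 m (by simp; omega) _ (by simp; omega) (by omega)
  rw [Nat.card_Ioc, Nat.add_sub_cancel_left, nsmul_eq_mul, ← h1] at h5
  exact le_of_mul_le_mul_left h5 (by exact_mod_cast card_tied_pos v i)

theorem IsRankingRuleWith.le_of_lt {f : Rule n β} {π : ℕ → ℝ} (h : IsRankingRuleWith f π)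
    (v : Profile n β) (i : Fin n) {t : ℝ} (ht : v i < t) :
    f v i ≤ π (1 + countGE v (univ.erase i) t) := by
  have h1 := h.card_tied_mul v i
  have h2 := card_above_add_card_tied_le v i
  have h3 : countGE v (univ.erase i) t ≤ #(above v i) := by
    rw [← countGE_univ_of_lt ht, countGE]
    refine card_le_card fun j hj => ?_
    simp only [above, mem_filter, mem_univ, true_and] at *
    exact Subtype.coe_lt_coe.1 (ht.trans_le hj)
  have h4 := card_tied_pos v i
  rw [partialSum_add, add_sub_cancel_left] at h1
  have h5 := sum_le_card_nsmul (Ioc #(above v i) (#(above v i) + #(tied v i))) π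
    (π (1 + countGE v (univ.erase i) t)) fun m hm => by
      rw [mem_Ioc] at hm
      exact h.2.2.1.2.1 _ (by simp; omega) m (by simp; omega) (by omega)
  rw [Nat.card_Ioc, Nat.add_sub_cancel_left, nsmul_eq_mul, ← h1] at h5
  exact le_of_mul_le_mul_left h5 (by exact_mod_cast h4)

theorem countGE_update (v : Profile n β) (i : Fin n) (x : Set.Icc (0 : ℝ) β) (t : ℝ) :
    countGE (Function.update v i x) (univ.erase i) t = countGE v (univ.erase i) t := by
  rw [countGE, countGE]
  congr 1
  refine filter_congr fun j hj => ?_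
  rw [Function.update_of_ne (ne_of_mem_erase hj)]

/-- The rebate does not depend on agent `i`'s report, so the gain from reporting `x` is `(v i - x)
f(x)` minus the integral of the rank probability from `x` to `v i`. Monotonicity in the threshold
makes it nonpositive. -/
theorem IsRankingRuleWith.isDSIC_rankingPayment {f : Rule n β} {π : ℕ → ℝ}
    (h : IsRankingRuleWith f π) (A : ℕ → ℝ) : IsDSIC f (rankingPayment f π A) := by
  intro i v x
  have hle : ∀ t ≤ (x : ℝ), π (1 + countGE v (univ.erase i) t) ≤ f (Function.update v i x) i := by
    intro t ht
    have := h.le_of_le (Function.update v i x) i (t := t) (by simpa using ht)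
    rwa [countGE_update] at this
  have hlt : ∀ t, (x : ℝ) < t →
      f (Function.update v i x) i ≤ π (1 + countGE v (univ.erase i) t) := by
    intro t ht
    have := h.le_of_lt (Function.update v i x) i (t := t) (by simpa using ht)
    rwa [countGE_update] at this
  have hint := fun a b => intervalIntegrable_comp_countGE v (univ.erase i) (fun m => π (1 + m)) a b
  have key : ((v i : ℝ) - x) * f (Function.update v i x) i ≤
      ∫ t in (x : ℝ)..v i, π (1 + countGE v (univ.erase i) t) := by
    rcases le_total (x : ℝ) (v i) with hxv | hxv
    · have := intervalIntegral.integral_mono_on_of_le_Ioo hxv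
        (f := fun _ => f (Function.update v i x) i) intervalIntegrable_const (hint _ _)
        fun t ht => hlt t ht.1
      simpa using this
    · have := intervalIntegral.integral_mono_on hxv (hint _ _)
        (g := fun _ => f (Function.update v i x) i) intervalIntegrable_const
        fun t ht => hle t ht.2
      rw [intervalIntegral.integral_symm]
      simp only [intervalIntegral.integral_const, smul_eq_mul] at this
      linarith
  have hsub := intervalIntegral.integral_interval_sub_left (hint 0 (v i)) (hint 0 x)
  simp only [rankingPayment, countGE_update, Function.update_self]
  linarith

theorem isSymmetric_rankingPayment {f : Rule n β} (hf : IsSymmetric f) (π A : ℕ → ℝ) :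
    IsSymmetric (rankingPayment f π A) := by
  intro v i j hij
  have h : countGE v (univ.erase i) = countGE v (univ.erase j) := by
    funext t
    by_cases ht : t ≤ v i
    · have h1 := countGE_univ_of_le ht
      have h2 := countGE_univ_of_le (hij ▸ ht : t ≤ v j)
      omega
    · rw [← countGE_univ_of_lt (not_le.1 ht), ← countGE_univ_of_lt (i := j) (hij ▸ not_le.1 ht)]
  simp only [rankingPayment, h, hij, hf v i j hij]

/-! ### The budget condition and its sufficiency -/

/-- The alternating sum that has to vanish for budget balance. -/
noncomputable def budgetDefect (n : ℕ) (π : ℕ → ℝ) : ℝ :=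
  ∑ J ∈ range (n + 1), (-1) ^ J * (n.choose J : ℝ) * (partialSum π J - J * π J)

/-- Summation by parts based on Pascal's rule; the boundary term vanishes for `N = n + 1`. -/
theorem sum_alternating_choose_mul (n N : ℕ) (R : ℕ → ℝ) :
    ∑ J ∈ range (N + 1), (-1) ^ J * ((n + 1).choose J : ℝ) * R J =
      (-1) ^ N * (n.choose N : ℝ) * R N -
        ∑ k ∈ range N, (-1) ^ k * (n.choose k : ℝ) * (R (k + 1) - R k) := by
  induction N with
  | zero => simp
  | succ N ih =>
    rw [sum_range_succ, ih, sum_range_succ _ N, Nat.choose_succ_succ]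
    push_cast
    ring

/-- The increments of `Π_J - J π_J` are `k (π_k - π_{k+1})`, and the factor `k` is absorbed into the
binomial coefficient. -/
theorem budgetDefect_add_two (m : ℕ) (π : ℕ → ℝ) :
    budgetDefect (m + 2) π =
      (m + 1) * ∑ k ∈ range (m + 1), (-1) ^ k * (m.choose k : ℝ) * (π (k + 1) - π (k + 2)) := by
  rw [budgetDefect, sum_alternating_choose_mul (m + 1) (m + 2), Nat.choose_succ_self,
    sum_range_succ']
  simp only [Nat.cast_zero, mul_zero, zero_mul, zero_add, partialSum_succ, zero_sub]
  rw [mul_sum, neg_add, ← sum_neg_distrib]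
  have : ∀ k, ((m + 1 : ℕ).choose (k + 1) : ℝ) * (k + 1) = (m + 1) * (m.choose k : ℝ) := by
    intro k
    exact_mod_cast (Nat.add_one_mul_choose_eq m k).symm
  have h0 : -((-1) ^ 0 * ((m + 1).choose 0 : ℝ) * (partialSum π 0 + π 1 - ((1 : ℕ) : ℝ) * π 1 -
    (partialSum π 0 - 0))) = 0 := by simp
  rw [h0, add_zero]
  refine sum_congr rfl fun k _ => ?_
  push_cast
  linear_combination (-1) ^ k * (π (k + 1) - π (k + 2)) * this k

/-- Rebates that balance the budget when the alternating sum vanishes. -/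
noncomputable def rebate (n : ℕ) (π : ℕ → ℝ) (J : ℕ) : ℝ :=
  (-1) ^ (J + 1) / ((J + 1) * (n.choose (J + 1) : ℝ)) *
    ∑ m ∈ range (J + 1), (-1) ^ m * (n.choose m : ℝ) * (partialSum π m - m * π m)

/-- Multiplying the recursion by `(-1)^J C(n,J)` and using `(n - J) C(n,J) = (J + 1) C(n,J+1)` makes
it telescope, which is how `rebate` is found. The hypothesis enters only at `J = n`, where no new
rebate is available. -/
theorem rebate_recursion {π : ℕ → ℝ} (h : budgetDefect n π = 0) {J : ℕ} (hJ : J ≤ n) :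
    partialSum π J - J * π J + J * rebate n π (J - 1) + (n - J) * rebate n π J = 0 := by
  rcases J with _ | K
  · simp [rebate, partialSum_zero]
  have hC : (n.choose (K + 1) : ℝ) ≠ 0 := by exact_mod_cast (Nat.choose_pos hJ).ne'
  have hsq : ((-1 : ℝ) ^ K) * (-1) ^ K = 1 := by rw [← mul_pow]; simp
  have h1 : ((K + 1 : ℕ) : ℝ) * rebate n π K = (-1) ^ (K + 1) / (n.choose (K + 1) : ℝ) *
      ∑ m ∈ range (K + 1), (-1) ^ m * (n.choose m : ℝ) * (partialSum π m - m * π m) := by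
    have : (K : ℝ) + 1 ≠ 0 := by positivity
    rw [rebate]
    push_cast
    field_simp
  have h2 : ((n : ℝ) - (K + 1 : ℕ)) * rebate n π (K + 1) =
      (-1) ^ (K + 2) / (n.choose (K + 1) : ℝ) *
      ∑ m ∈ range (K + 2), (-1) ^ m * (n.choose m : ℝ) * (partialSum π m - m * π m) := by
    rcases hJ.lt_or_eq with hlt | rfl
    · have hC' : (n.choose (K + 2) : ℝ) ≠ 0 := by exact_mod_cast (Nat.choose_pos hlt).ne'
      have h3 : (n.choose (K + 2) : ℝ) * (K + 2) = n.choose (K + 1) * (n - (K + 1 : ℕ)) := by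
        rw [← Nat.cast_sub hJ]
        exact_mod_cast Nat.choose_succ_right_eq n (K + 1)
      have h4 : (K : ℝ) + 2 ≠ 0 := by positivity
      have h5 : ((n : ℝ) - (K + 1 : ℕ)) / ((K + 2) * (n.choose (K + 2) : ℝ)) =
          1 / (n.choose (K + 1) : ℝ) := by
        rw [div_eq_div_iff (by positivity) hC]
        linarith
      rw [rebate]
      push_cast at h5 ⊢
      rw [add_assoc (K : ℝ), one_add_one_eq_two]
      linear_combination (-1) ^ (K + 2) * (∑ m ∈ range (K + 2), (-1) ^ m * (n.choose m : ℝ) *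
        (partialSum π m - m * π m)) * h5
    · rw [budgetDefect] at h
      rw [h]
      simp
  rw [Nat.add_sub_cancel, h1, h2, sum_range_succ _ (K + 1)]
  field_simp
  ring_nf
  ring_nf at hsq
  rw [hsq]
  ring

theorem IsRankingRuleWith.isSatisfactorilyImplementable {f : Rule n β} {π : ℕ → ℝ}
    (hf : IsRankingRuleWith f π) (h : budgetDefect n π = 0) : IsSatisfactorilyImplementable f :=
  ⟨rankingPayment f π (rebate n π), hf.isDSIC_rankingPayment _,
    hf.isBudgetBalanced_rankingPayment fun _ hJ => rebate_recursion h hJ, hf.2.1,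
    isSymmetric_rankingPayment hf.2.1 _ _⟩

/-! ### Necessity of the budget condition -/

/-- Payoff equivalence for one agent whose allocation is constant in the interior. -/
theorem payment_sub_payment_of_const {β c : ℝ} (hβ : 0 < β) {φ q : Set.Icc (0 : ℝ) β → ℝ}
    (h : ∀ x y : Set.Icc (0 : ℝ) β, (x : ℝ) * φ y - q y ≤ x * φ x - q x)
    (hc : ∀ x : Set.Icc (0 : ℝ) β, 0 < (x : ℝ) → (x : ℝ) < β → φ x = c) :
    q ⟨β, hβ.le, le_rfl⟩ - q ⟨0, le_rfl, hβ.le⟩ = β * (φ ⟨β, hβ.le, le_rfl⟩ - c) := by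
  set b : Set.Icc (0 : ℝ) β := ⟨β, hβ.le, le_rfl⟩
  set o : Set.Icc (0 : ℝ) β := ⟨0, le_rfl, hβ.le⟩
  set m : Set.Icc (0 : ℝ) β := ⟨β / 2, by linarith, by linarith⟩
  have hm : φ m = c := hc m (half_pos hβ) (half_lt_self hβ)
  -- Reports with equal allocation must carry equal payments.
  have hq : ∀ x : Set.Icc (0 : ℝ) β, 0 < (x : ℝ) → (x : ℝ) < β → q x = q m := by
    intro x h0 h1
    have h2 := h x m
    have h3 := h m x
    rw [hc x h0 h1, hm] at h2 h3
    linarith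
  -- Incentive constraints of interior types against an endpoint report are affine in the type, so
  -- they pass to the endpoint; this gives the inequalities opposite to those of the endpoint types
  -- themselves.
  have hlim : ∀ a d : ℝ, (∀ x ∈ Set.Ioo 0 β, a ≤ x * d) → ∀ x ∈ Set.Icc 0 β, a ≤ x * d := by
    intro a d h' x hx
    rw [← closure_Ioo hβ.ne] at hx
    exact le_on_closure h' (by fun_prop) (by fun_prop) hx
  have h1 : q o = q m := by
    refine le_antisymm ?_ ?_
    · have := h o m
      simp only [o, zero_mul, zero_sub, neg_le_neg_iff] at this
      exact this
    · have := hlim (q m - q o) (c - φ o) (fun x hx => ?_) 0 ⟨le_rfl, hβ.le⟩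
      · linarith
      · have h2 := h ⟨x, hx.1.le, hx.2.le⟩ o
        rw [hc ⟨x, hx.1.le, hx.2.le⟩ hx.1 hx.2, hq ⟨x, hx.1.le, hx.2.le⟩ hx.1 hx.2] at h2
        simp only at h2
        linarith
  have h2 : q b - q m ≤ β * (φ b - c) := by
    have := h b m
    rw [hm] at this
    simp only [b] at this ⊢
    linarith
  have h3 := hlim (q m - q b) (c - φ b) (fun x hx => ?_) β ⟨hβ.le, le_rfl⟩
  · linarith
  · have h2 := h ⟨x, hx.1.le, hx.2.le⟩ b
    rw [hc ⟨x, hx.1.le, hx.2.le⟩ hx.1 hx.2, hq ⟨x, hx.1.le, hx.2.le⟩ hx.1 hx.2] at h2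
    simp only at h2
    linarith

/-- The profile in which the agents in `S` have the highest valuation and the others the lowest. -/
noncomputable def extremeProfile (hβ : 0 < β) (S : Finset (Fin n)) : Profile n β := fun i =>
  if i ∈ S then ⟨β, hβ.le, le_rfl⟩ else ⟨0, le_rfl, hβ.le⟩

theorem isUpperAt_extremeProfile (hβ : 0 < β) (S : Finset (Fin n)) :
    IsUpperAt (extremeProfile hβ S) S := by
  intro j hj i hij
  by_contra hi
  simp only [extremeProfile, hj, hi, if_true, if_false] at hij
  exact hβ.not_ge hij

theorem update_extremeProfile (hβ : 0 < β) {S : Finset (Fin n)} {i : Fin n} (hi : i ∉ S) :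
    Function.update (extremeProfile hβ S) i ⟨β, hβ.le, le_rfl⟩ =
      extremeProfile hβ (insert i S) := by
  funext j
  by_cases h : j = i
  · subst h; simp [extremeProfile]
  · simp [extremeProfile, h]

/-- An interior valuation is strictly below those of `S` and strictly above all others, so the agent
holds rank `#S + 1` untied. -/
theorem IsRankingRuleWith.update_extremeProfile {f : Rule n β} {π : ℕ → ℝ}
    (hf : IsRankingRuleWith f π) (hβ : 0 < β) {S : Finset (Fin n)} {i : Fin n} (hi : i ∉ S)
    (x : Set.Icc (0 : ℝ) β) (h0 : 0 < (x : ℝ)) (h1 : (x : ℝ) < β) :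
    f (Function.update (extremeProfile hβ S) i x) i = π (#S + 1) := by
  have ha : above (Function.update (extremeProfile hβ S) i x) i = S := by
    ext j
    by_cases h : j = i
    · subst h; simp [above, hi]
    · by_cases hj : j ∈ S
      · simpa [above, extremeProfile, h, hj, ← Subtype.coe_lt_coe] using h1
      · simpa [above, extremeProfile, h, hj, ← Subtype.coe_le_coe] using h0.le
  have ht : tied (Function.update (extremeProfile hβ S) i x) i = {i} := by
    ext j
    by_cases h : j = i
    · subst h; simp [tied]
    · by_cases hj : j ∈ S
      · simpa [tied, extremeProfile, h, hj, Subtype.ext_iff] using h1.ne'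
      · simpa [tied, extremeProfile, h, hj, Subtype.ext_iff] using h0.ne
  have := hf.card_tied_mul (Function.update (extremeProfile hβ S) i x) i
  rw [ha, ht, card_singleton, partialSum_succ] at this
  simpa using this

theorem IsRankingRuleWith.payment_sub_payment {f p : Rule n β} {π : ℕ → ℝ}
    (hf : IsRankingRuleWith f π) (hp : IsDSIC f p) (hβ : 0 < β) {S : Finset (Fin n)} {i : Fin n}
    (hi : i ∉ S) :
    p (extremeProfile hβ (insert i S)) i - p (extremeProfile hβ S) i =
      β * (f (extremeProfile hβ (insert i S)) i - π (#S + 1)) := by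
  have h := payment_sub_payment_of_const (c := π (#S + 1)) hβ
    (φ := fun x => f (Function.update (extremeProfile hβ S) i x) i)
    (q := fun x => p (Function.update (extremeProfile hβ S) i x) i) (fun x y => ?_)
    (hf.update_extremeProfile hβ hi)
  · have h0 : Function.update (extremeProfile hβ S) i ⟨0, le_rfl, hβ.le⟩ = extremeProfile hβ S :=
      Function.update_eq_self_iff.2 (by simp [extremeProfile, hi])
    simp only [RankingMechanism.update_extremeProfile hβ hi, h0] at h
    exact h
  · have := hp i (Function.update (extremeProfile hβ S) i x) y
    simpa using this

/-- Pair each `S` avoiding `i` with `insert i S`: only the effect of agent `i`'s own change of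
report survives. -/
theorem sum_alternating_eq {ι : Type*} [Fintype ι] [DecidableEq ι] (i : ι) (q : Finset ι → ℝ) :
    ∑ S : Finset ι, (-1) ^ #S * q S =
      -∑ S ∈ (univ.erase i).powerset, (-1) ^ #S * (q (insert i S) - q S) := by
  rw [← powerset_univ, ← insert_erase (mem_univ i), sum_powerset_insert (notMem_erase i univ),
    ← sum_add_distrib, ← sum_neg_distrib, erase_insert (notMem_erase i univ)]
  refine sum_congr rfl fun S hS => ?_
  rw [card_insert_of_notMem fun h => notMem_erase i univ (mem_powerset.1 hS h)]
  ring

theorem sum_alternating_mem {ι : Type*} [Fintype ι] [DecidableEq ι] (i : ι) (q : Finset ι → ℝ) :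
    ∑ S : Finset ι, (-1) ^ #S * (if i ∈ S then q S else 0) =
      -∑ S ∈ (univ.erase i).powerset, (-1) ^ #S * q (insert i S) := by
  rw [sum_alternating_eq i]
  congr 1
  refine sum_congr rfl fun S hS => ?_
  rw [if_pos (mem_insert_self i S), if_neg fun h => notMem_erase i univ (mem_powerset.1 hS h),
    sub_zero]

/-- Budget balance kills the alternating sum of all payments over the profiles `extremeProfile hβ
S`. Computed agent by agent, the same sum involves only payment differences, which incentive
compatibility fixes through the allocation. -/
theorem IsRankingRuleWith.budgetDefect_eq_zero {f : Rule n β} {π : ℕ → ℝ}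
    (hf : IsRankingRuleWith f π) (hβ : 0 < β) (h : IsSatisfactorilyImplementable f) :
    budgetDefect n π = 0 := by
  obtain ⟨p, hp, hb, -, -⟩ := h
  have h1 : ∑ S : Finset (Fin n), ∑ i, (-1) ^ #S * p (extremeProfile hβ S) i = 0 :=
    sum_eq_zero fun S _ => by rw [← mul_sum, hb, mul_zero]
  have h2 : ∀ i, ∑ S : Finset (Fin n), (-1) ^ #S * p (extremeProfile hβ S) i =
      ∑ S : Finset (Fin n), (-1) ^ #S * (if i ∈ S then
        β * (f (extremeProfile hβ S) i - π #S) else 0) := by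
    intro i
    rw [sum_alternating_eq i, sum_alternating_mem i]
    congr 1
    refine sum_congr rfl fun S hS => ?_
    have hi : i ∉ S := fun h => notMem_erase i univ (mem_powerset.1 hS h)
    rw [hf.payment_sub_payment hp hβ hi, card_insert_of_notMem hi]
  rw [sum_comm, sum_congr rfl fun i _ => h2 i, sum_comm] at h1
  have h3 : ∀ S : Finset (Fin n), ∑ i, (-1) ^ #S * (if i ∈ S then
        β * (f (extremeProfile hβ S) i - π #S) else 0) =
      β * ((-1) ^ #S * (partialSum π #S - #S * π #S)) := by
    intro S
    rw [← mul_sum, sum_ite_mem, univ_inter, ← mul_sum, sum_sub_distrib,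
      hf.sum_upper (isUpperAt_extremeProfile hβ S)]
    simp
    ring
  rw [sum_congr rfl fun S _ => h3 S, ← mul_sum] at h1
  have h4 := (mul_eq_zero.1 h1).resolve_left hβ.ne'
  rw [← powerset_univ, sum_powerset_apply_card fun J => (-1) ^ J * (partialSum π J - J * π J),
    card_univ, Fintype.card_fin] at h4
  rw [budgetDefect, ← h4]
  refine sum_congr rfl fun J _ => ?_
  rw [nsmul_eq_mul]
  ring

/-! ### Unique maximizer of `(choose m j + 1) / j` over odd `j` -/

/-- `choose m (j + 2) / (j + 2)` exceeds `choose m j / j`, where `m = j + 2 + r`. -/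
def StepUp (j r : ℕ) : Prop := (j + 1) * (j + 2) ^ 2 < j * ((r + 2) * (r + 1))

theorem choose_add_two_mul (j r : ℕ) :
    (j + 2 + r).choose (j + 2) * ((j + 1) * (j + 2)) =
      (j + 2 + r).choose j * ((r + 2) * (r + 1)) := by
  have h1 := Nat.choose_succ_right_eq (j + 2 + r) (j + 1)
  have h2 := Nat.choose_succ_right_eq (j + 2 + r) j
  rw [show j + 2 + r - (j + 1) = r + 1 by omega] at h1
  rw [show j + 2 + r - j = r + 2 by omega] at h2
  calc _ = ((j + 2 + r).choose (j + 1 + 1) * (j + 1 + 1)) * (j + 1) := by ring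
    _ = ((j + 2 + r).choose (j + 1) * (j + 1)) * (r + 1) := by rw [h1]; ring
    _ = _ := by rw [h2]; ring

/-- `StepUp` forces `r ≥ j + 2`, so the coefficient is at least `C(j+5, 5)`, a polynomial of degree
five in `j`. -/
theorem lt_choose_of_stepUp {j r : ℕ} (hj : 3 ≤ j) (h : StepUp j r) :
    2 * ((j + 1) * (j + 2)) < (j + 2 + r).choose j := by
  have hr : j + 2 ≤ r := by
    by_contra hr
    have h1 : (r + 2) * (r + 1) ≤ (j + 3) * (j + 2) := Nat.mul_le_mul (by omega) (by omega)
    have h2 := Nat.mul_le_mul_left j h1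
    unfold StepUp at h
    nlinarith
  have h1 : (j + 5).choose j ≤ (j + 2 + r).choose j := Nat.choose_le_choose j (by omega)
  refine lt_of_lt_of_le ?_ h1
  have h2 := Nat.descFactorial_eq_factorial_mul_choose (j + 5) 5
  rw [← Nat.choose_symm_add] at h2
  simp only [Nat.descFactorial, Nat.factorial] at h2
  obtain ⟨k, rfl⟩ := Nat.exists_eq_add_of_le hj
  have h3 : 336 ≤ (k + 8) * ((k + 7) * (k + 6)) :=
    Nat.mul_le_mul (by omega : 8 ≤ k + 8) (Nat.mul_le_mul (by omega : 7 ≤ k + 7) (by omega : 6 ≤ k + 6))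
  have h4 := Nat.mul_le_mul_right ((k + 5) * (k + 4)) h3
  rw [show 3 + k + 5 - 4 = k + 4 by omega, show 3 + k + 5 - 3 = k + 5 by omega,
    show 3 + k + 5 - 2 = k + 6 by omega, show 3 + k + 5 - 1 = k + 7 by omega,
    show 3 + k + 5 - 0 = k + 8 by omega] at h2
  have h5 : 336 * ((k + 5) * (k + 4)) ≤ 120 * (3 + k + 5).choose (3 + k) := by
    refine h4.trans (le_of_eq ?_)
    rw [show 120 = Nat.succ 4 * (Nat.succ 3 * (Nat.succ 2 * (Nat.succ 1 * (Nat.succ 0 * 1)))) by rfl,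
      ← h2]
    ring
  have h6 : 0 < (k + 5) * (k + 4) := Nat.mul_pos (by omega) (by omega)
  rw [show (3 + k + 1) * (3 + k + 2) = (k + 5) * (k + 4) by ring]
  omega

/-- The added `1`s work against the step up and cost `2 (j+1)(j+2)` after clearing denominators. For
`j ≥ 3` a gap of one unit in `StepUp`, multiplied by the binomial coefficient, already pays for
this. -/
theorem StepUp.lt {j r : ℕ} (hj : 1 ≤ j) (hj2 : j ≠ 2) (hm : 7 ≤ j + 2 + r) (h : StepUp j r) :
    ((j + 2 + r).choose j + 1) * (j + 2) < ((j + 2 + r).choose (j + 2) + 1) * j := by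
  have h0 := choose_add_two_mul j r
  have h1 : 2 * ((j + 1) * (j + 2)) + (j + 2 + r).choose j * ((j + 1) * (j + 2) ^ 2) <
      (j + 2 + r).choose j * (j * ((r + 2) * (r + 1))) := by
    unfold StepUp at h
    rcases hj.eq_or_lt with rfl | hj
    · rw [Nat.choose_one_right]
      -- Here `7 ≤ m` is needed: for `j = 1`, `r = 3`, that is `m = 6`, the two sides are equal.
      obtain ⟨k, rfl⟩ := Nat.exists_eq_add_of_le (show 4 ≤ r by omega)
      nlinarith
    · have h2 := lt_choose_of_stepUp (by omega) h
      have h3 := Nat.mul_le_mul_left ((j + 2 + r).choose j) (Nat.succ_le_of_lt h)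
      rw [Nat.succ_eq_add_one, mul_add] at h3
      omega
  refine lt_of_mul_lt_mul_left (a := (j + 1) * (j + 2)) ?_ (Nat.zero_le _)
  calc _ = (2 * ((j + 1) * (j + 2)) + (j + 2 + r).choose j * ((j + 1) * (j + 2) ^ 2)) +
        (j + 1) * (j + 2) * j := by ring
    _ < (j + 2 + r).choose j * (j * ((r + 2) * (r + 1))) + (j + 1) * (j + 2) * j := by omega
    _ = ((j + 2 + r).choose j * ((r + 2) * (r + 1))) * j + (j + 1) * (j + 2) * j := by ring
    _ = _ := by rw [← h0]; ring

/-- In this direction the added `1`s help, as `j < j + 2`, so a weak inequality becomes strict. -/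
theorem lt_of_not_stepUp {j r : ℕ} (h : ¬ StepUp j r) :
    ((j + 2 + r).choose (j + 2) + 1) * j < ((j + 2 + r).choose j + 1) * (j + 2) := by
  have h0 := choose_add_two_mul j r
  unfold StepUp at h
  have h1 := Nat.mul_le_mul_left ((j + 2 + r).choose j) (not_lt.1 h)
  refine lt_of_mul_lt_mul_left (a := (j + 1) * (j + 2)) ?_ (Nat.zero_le _)
  calc _ = ((j + 2 + r).choose (j + 2) * ((j + 1) * (j + 2))) * j + (j + 1) * (j + 2) * j := by ring
    _ = (j + 2 + r).choose j * (j * ((r + 2) * (r + 1))) + (j + 1) * (j + 2) * j := by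
      rw [h0]; ring
    _ < (j + 2 + r).choose j * ((j + 1) * (j + 2) ^ 2) + (j + 1) * (j + 2) * (j + 2) := by nlinarith
    _ = _ := by ring

theorem not_stepUp_add_two {j r : ℕ} (hj : 1 ≤ j) (h : ¬ StepUp j (r + 2)) :
    ¬ StepUp (j + 2) r := by
  unfold StepUp at *
  rw [not_lt] at *
  refine Nat.le_of_mul_le_mul_left ?_ hj
  calc _ ≤ (j + 2) * (j * ((r + 2 + 2) * (r + 2 + 1))) := by
          rw [mul_left_comm]
          exact Nat.mul_le_mul_left _ (Nat.mul_le_mul_left _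
            (Nat.mul_le_mul (by omega) (by omega)))
    _ ≤ (j + 2) * ((j + 1) * (j + 2) ^ 2) := Nat.mul_le_mul_left _ h
    _ ≤ _ := by
      have : 0 ≤ j * j * j * j := Nat.zero_le _
      nlinarith

/-- `(choose m j + 1) / j` decreases once it does not increase. -/
theorem lt_of_not_stepUp_of_lt {j : ℕ} (hj : 1 ≤ j) (t r : ℕ) (h : ¬ StepUp j (2 * t + r)) :
    ¬ StepUp (j + 2 * t) r ∧
    ((j + 2 * t + 2 + r).choose (j + 2 * t + 2) + 1) * j <
      ((j + 2 * t + 2 + r).choose j + 1) * (j + 2 * t + 2) := by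
  induction t generalizing r with
  | zero =>
    simp only [mul_zero, zero_add, add_zero] at *
    exact ⟨h, lt_of_not_stepUp h⟩
  | succ t ih =>
    obtain ⟨h1, h2⟩ := ih (r + 2) (by rwa [show 2 * t + (r + 2) = 2 * (t + 1) + r by ring])
    have h3 := not_stepUp_add_two (by omega) h1
    have h4 := lt_of_not_stepUp h3
    rw [show j + 2 * (t + 1) = j + 2 * t + 2 by ring]
    refine ⟨h3, ?_⟩
    rw [show j + 2 * t + 2 + (r + 2) = j + 2 * t + 2 + 2 + r by ring] at h2
    refine lt_of_mul_lt_mul_left (a := j + 2 * t + 2) ?_ (Nat.zero_le _)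
    calc _ = (((j + 2 * t + 2 + 2 + r).choose (j + 2 * t + 2 + 2) + 1) * (j + 2 * t + 2)) * j := by
          ring
      _ ≤ (((j + 2 * t + 2 + 2 + r).choose (j + 2 * t + 2) + 1) * (j + 2 * t + 2 + 2)) * j :=
          Nat.mul_le_mul_right _ h4.le
      _ = (((j + 2 * t + 2 + 2 + r).choose (j + 2 * t + 2) + 1) * j) * (j + 2 * t + 2 + 2) := by ring
      _ < (((j + 2 * t + 2 + 2 + r).choose j + 1) * (j + 2 * t + 2)) * (j + 2 * t + 2 + 2) :=
          Nat.mul_lt_mul_of_pos_right h2 (by omega)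
      _ = _ := by ring

/-- A step up would contradict `h2` by `StepUp.lt`; without it the values decrease strictly from `j`
on. -/
theorem not_both_maximal {m j k : ℕ} (hm : 7 ≤ m) (hj : Odd j) (hk : Odd k) (hkm : k ≤ m)
    (hjk : j < k) (h2 : (m.choose (j + 2) + 1) * j ≤ (m.choose j + 1) * (j + 2)) :
    (m.choose k + 1) * j < (m.choose j + 1) * k := by
  obtain ⟨a, rfl⟩ := hj
  obtain ⟨b, rfl⟩ := hk
  obtain ⟨t, rfl⟩ := Nat.exists_eq_add_of_lt (show a < b by omega)
  obtain ⟨r, rfl⟩ := Nat.exists_eq_add_of_le hkm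
  have h : ¬ StepUp (2 * a + 1) (2 * t + r) := by
    intro h
    have h3 := h.lt (by omega) (by omega) (by omega)
    rw [show 2 * a + 1 + 2 + (2 * t + r) = 2 * (a + t + 1) + 1 + r by ring] at h3
    omega
  have h3 := (lt_of_not_stepUp_of_lt (by omega) t r h).2
  rw [show 2 * a + 1 + 2 * t + 2 = 2 * (a + t + 1) + 1 by ring] at h3
  exact h3

/-- For `m ≥ 7` the maximizer of `(choose m j + 1) / j` over odd `j` is unique. -/
theorem maximizer_unique {m j k : ℕ} (hm : 7 ≤ m) (hj : Odd j) (hjm : j ≤ m)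
    (hmax : ∀ i ≤ m, Odd i → (m.choose i + 1) * j ≤ (m.choose j + 1) * i)
    (hk : Odd k) (hkm : k ≤ m) (hne : k ≠ j) :
    (m.choose k + 1) * j < (m.choose j + 1) * k := by
  rcases hne.lt_or_gt with h | h
  · refine lt_of_le_of_ne (hmax k hkm hk) fun heq => ?_
    have hk0 := hk.pos
    have hj0 := hj.pos
    have h2 : k + 2 ≤ j := by
      obtain ⟨a, rfl⟩ := hk
      obtain ⟨b, rfl⟩ := hj
      omega
    have h3 := hmax (k + 2) (h2.trans hjm) (hk.add_even even_two)
    have h4 : (m.choose (k + 2) + 1) * k ≤ (m.choose k + 1) * (k + 2) := by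
      refine Nat.le_of_mul_le_mul_left ?_ hj0
      calc _ = ((m.choose (k + 2) + 1) * j) * k := by ring
        _ ≤ ((m.choose j + 1) * (k + 2)) * k := Nat.mul_le_mul_right _ h3
        _ = ((m.choose j + 1) * k) * (k + 2) := by ring
        _ = _ := by rw [← heq]; ring
    -- A tie makes `k` a maximizer as well, hence no worse than `k + 2`; then `k` would strictly
    -- beat the later `j`.
    have h5 := not_both_maximal hm hk hj hjm h h4
    omega
  · refine not_both_maximal hm hj hk hkm h (hmax _ ?_ (hj.add_even even_two))
    obtain ⟨a, rfl⟩ := hk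
    obtain ⟨b, rfl⟩ := hj
    omega

/-! ### The linear programme for the top-rank probability -/

/-- The rank probabilities, indexed from `0` and extended by zero. -/
noncomputable def extendedProb (n : ℕ) (π : ℕ → ℝ) (j : ℕ) : ℝ := if j < n then π (j + 1) else 0

/-- The drop in the rank probabilities after rank `j + 1`. -/
noncomputable def probDrop (n : ℕ) (π : ℕ → ℝ) (j : ℕ) : ℝ :=
  extendedProb n π j - extendedProb n π (j + 1)

theorem probDrop_nonneg {π : ℕ → ℝ} (h : IsRankProbabilities n π) (j : ℕ) (hj : j < n) :
    0 ≤ probDrop n π j := by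
  rw [probDrop, extendedProb, extendedProb, if_pos hj]
  split_ifs with h1
  · exact sub_nonneg.2 (h.2.1 (j + 1) (by simp; omega) (j + 1 + 1) (by simp; omega) (by omega))
  · simpa using (h.1 (j + 1) (by simp; omega)).1

theorem sum_probDrop (hn : 0 < n) (π : ℕ → ℝ) : ∑ j ∈ range n, probDrop n π j = π 1 := by
  simp only [probDrop, sum_range_sub', extendedProb, hn, lt_irrefl, if_true, if_false, sub_zero,
    zero_add]

theorem sum_extendedProb (π : ℕ → ℝ) {J : ℕ} (hJ : J ≤ n) :
    ∑ j ∈ range J, extendedProb n π j = partialSum π J := by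
  induction J with
  | zero => simp [partialSum_zero]
  | succ J ih =>
    rw [sum_range_succ, ih (by omega), partialSum_succ, extendedProb, if_pos (by omega)]

theorem sum_mul_sub_succ (τ : ℕ → ℝ) (N : ℕ) :
    ∑ j ∈ range N, ((j : ℝ) + 1) * (τ j - τ (j + 1)) = ∑ j ∈ range N, τ j - N * τ N := by
  induction N with
  | zero => simp
  | succ N ih =>
    rw [sum_range_succ, ih, sum_range_succ]
    push_cast
    ring

theorem sum_mul_probDrop (n : ℕ) (π : ℕ → ℝ) :
    ∑ j ∈ range n, ((j : ℝ) + 1) * probDrop n π j = partialSum π n := by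
  simp only [probDrop]
  rw [sum_mul_sub_succ, sum_extendedProb π le_rfl, extendedProb, if_neg (lt_irrefl n), mul_zero,
    sub_zero]

theorem budgetDefect_eq_zero_iff (m : ℕ) (π : ℕ → ℝ) :
    budgetDefect (m + 2) π = 0 ↔
      ∑ j ∈ range (m + 2), (-1) ^ j * (m.choose j : ℝ) * probDrop (m + 2) π j = 0 := by
  have hm : (m : ℝ) + 1 ≠ 0 := by positivity
  rw [budgetDefect_add_two, mul_eq_zero, or_iff_right hm, sum_range_succ _ (m + 1),
    Nat.choose_succ_self, Nat.cast_zero, mul_zero, zero_mul, add_zero]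
  refine Eq.congr_left (sum_congr rfl fun j hj => ?_)
  have := mem_range.1 hj
  rw [probDrop, extendedProb, extendedProb, if_pos (by omega), if_pos (by omega)]

theorem partialSum_eq_of_probDrop_eq {π ρ : ℕ → ℝ}
    (h : ∀ j < n, probDrop n π j = probDrop n ρ j) {J : ℕ} (hJ : J ≤ n) :
    partialSum π J = partialSum ρ J := by
  have hext : ∀ k, extendedProb n π (n - k) = extendedProb n ρ (n - k) := by
    intro k
    induction k with
    | zero => simp [extendedProb]
    | succ k ih =>
      by_cases hk : k < n
      · have h1 := h (n - (k + 1)) (by omega)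
        rw [probDrop, probDrop, show n - (k + 1) + 1 = n - k by omega, ih] at h1
        linarith
      · rwa [show n - (k + 1) = n - k by omega]
  rw [← sum_extendedProb π hJ, ← sum_extendedProb ρ hJ]
  refine sum_congr rfl fun j hj => ?_
  have := hext (n - j)
  rwa [Nat.sub_sub_self ((mem_range.1 hj).le.trans hJ)] at this

/-- The reduced cost of a drop after rank `j + 1` in the linear programme that maximizes the
probability of the first rank. -/
noncomputable def reducedCost (m : ℕ) (θ : ℝ) (j : ℕ) : ℝ :=
  (1 - θ) * (j + 1) + θ * ((-1) ^ j * (m.choose j : ℝ)) - 1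

/-- Duality identity: `1 - θ` prices the total probability `∑ (j+1) d_j` and `θ` prices the budget
equation, whose contribution is zero. -/
theorem sum_reducedCost_mul (m : ℕ) (θ : ℝ) {π : ℕ → ℝ} (h : budgetDefect (m + 2) π = 0) :
    ∑ j ∈ range (m + 2), reducedCost m θ j * probDrop (m + 2) π j =
      (1 - θ) * partialSum π (m + 2) - π 1 := by
  rw [budgetDefect_eq_zero_iff] at h
  rw [← sum_mul_probDrop, ← sum_probDrop (by omega : 0 < m + 2) π, mul_sum, ← sum_sub_distrib]
  have h2 : ∑ j ∈ range (m + 2), θ * ((-1) ^ j * (m.choose j : ℝ) * probDrop (m + 2) π j) = 0 := by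
    rw [← mul_sum, h, mul_zero]
  refine Eq.trans ?_ (add_zero _)
  rw [← h2, ← sum_add_distrib]
  refine sum_congr rfl fun j _ => ?_
  rw [reducedCost]
  ring

theorem reducedCost_zero (m : ℕ) (θ : ℝ) : reducedCost m θ 0 = 0 := by simp [reducedCost]

theorem reducedCost_of_odd {m j : ℕ} (θ : ℝ) (hj : Odd j) :
    reducedCost m θ j = j - θ * ((m.choose j : ℝ) + j + 1) := by
  rw [reducedCost, hj.neg_one_pow]
  ring

theorem reducedCost_pos_of_even {m j : ℕ} {θ : ℝ} (h0 : 0 ≤ θ) (h1 : θ * (m + 2) ≤ 1)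
    (hj : Even j) (hj0 : j ≠ 0) (hjm : j < m + 2) : 0 < reducedCost m θ j := by
  rw [reducedCost, hj.neg_one_pow]
  have h2 : (2 : ℝ) ≤ j := by
    obtain ⟨a, rfl⟩ := hj
    exact_mod_cast (by omega : 2 ≤ a + a)
  have h3 : (j : ℝ) + 1 ≤ m + 2 := by exact_mod_cast hjm
  have h4 := mul_le_mul_of_nonneg_left h3 h0
  have h5 : 0 ≤ θ * (1 * (m.choose j : ℝ)) := by positivity
  linarith

/-- The last drop, `j = m + 1`, has binomial coefficient zero and corresponds to no admissible `ℓ`,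
so `IsRatioBound` says nothing about it. -/
theorem reducedCost_add_one_pos {m : ℕ} {θ : ℝ} (hm : 1 ≤ m) (h1 : θ * (m + 2) ≤ 1)
    (hj : Odd (m + 1)) : 0 < reducedCost m θ (m + 1) := by
  rw [reducedCost_of_odd θ hj, Nat.choose_succ_self]
  have : (1 : ℝ) ≤ m := by exact_mod_cast hm
  push_cast
  linarith

/-- Lower bounds for the ratios `(i - 1) / (choose (n - 2) (i - 1) + i)`, `i` even, in terms of
`m = n - 2` and `j = i - 1`. -/
def IsRatioBound (m : ℕ) (θ : ℝ) : Prop :=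
  ∀ j ≤ m, Odd j → θ * ((m.choose j : ℝ) + j + 1) ≤ j

theorem IsRatioBound.mul_le_one {m : ℕ} {θ : ℝ} (hm : 1 ≤ m) (h : IsRatioBound m θ) :
    θ * (m + 2) ≤ 1 := by
  have := h 1 hm odd_one
  rw [Nat.choose_one_right] at this
  push_cast at this
  linarith

theorem IsRatioBound.lt_one {m : ℕ} {θ : ℝ} (hm : 1 ≤ m) (h : IsRatioBound m θ) : θ < 1 := by
  have h1 := h.mul_le_one hm
  by_contra h2
  have : (0 : ℝ) ≤ m := Nat.cast_nonneg m
  nlinarith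

theorem IsRatioBound.reducedCost_nonneg {m : ℕ} {θ : ℝ} (hm : 1 ≤ m) (h0 : 0 ≤ θ)
    (h : IsRatioBound m θ) {j : ℕ} (hj : j < m + 2) : 0 ≤ reducedCost m θ j := by
  rcases Nat.even_or_odd j with he | ho
  · rcases Nat.eq_zero_or_pos j with rfl | hpos
    · rw [reducedCost_zero]
    · exact (reducedCost_pos_of_even h0 (h.mul_le_one hm) he hpos.ne' hj).le
  · rcases (Nat.lt_succ_iff.1 hj).eq_or_lt with rfl | hlt
    · exact (reducedCost_add_one_pos hm (h.mul_le_one hm) ho).le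
    · rw [reducedCost_of_odd θ ho]
      linarith [h j (by omega) ho]

theorem IsRatioBound.prob_one_le {m : ℕ} {θ : ℝ} (hm : 1 ≤ m) (h0 : 0 ≤ θ) (h : IsRatioBound m θ)
    {π : ℕ → ℝ} (hπ : IsRankProbabilities (m + 2) π) (hb : budgetDefect (m + 2) π = 0) :
    π 1 ≤ 1 - θ := by
  have h1 : 0 ≤ ∑ j ∈ range (m + 2), reducedCost m θ j * probDrop (m + 2) π j :=
    sum_nonneg fun j hj => mul_nonneg (h.reducedCost_nonneg hm h0 (mem_range.1 hj))
      (probDrop_nonneg hπ j (mem_range.1 hj))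
  rw [sum_reducedCost_mul m θ hb] at h1
  have h2 : partialSum π (m + 2) ≤ 1 := hπ.2.2
  nlinarith [h.lt_one hm]

/-- Complementary slackness: at the optimum the total probability is one and every drop with
positive reduced cost vanishes. Only the drops `0` and `i` remain, and the two linear constraints
determine them. -/
theorem IsRatioBound.probDrop_of_eq {m : ℕ} {θ : ℝ} (hm : 1 ≤ m) (h0 : 0 ≤ θ)
    (h : IsRatioBound m θ) {i : ℕ} (hi : Odd i) (him : i ≤ m)
    (hlt : ∀ j ≤ m, Odd j → j ≠ i → θ * ((m.choose j : ℝ) + j + 1) < j)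
    {π : ℕ → ℝ} (hπ : IsRankProbabilities (m + 2) π) (hb : budgetDefect (m + 2) π = 0)
    (heq : π 1 = 1 - θ) :
    (∀ j < m + 2, j ≠ 0 → j ≠ i → probDrop (m + 2) π j = 0) ∧
      probDrop (m + 2) π 0 = m.choose i * probDrop (m + 2) π i ∧
      probDrop (m + 2) π i = 1 / ((m.choose i : ℝ) + i + 1) := by
  have hnn : ∀ j ∈ range (m + 2), 0 ≤ reducedCost m θ j * probDrop (m + 2) π j := fun j hj =>
    mul_nonneg (h.reducedCost_nonneg hm h0 (mem_range.1 hj)) (probDrop_nonneg hπ j (mem_range.1 hj))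
  have h1 := sum_nonneg hnn
  have hsum := sum_reducedCost_mul m θ hb
  have hθ := h.lt_one hm
  have h2 : partialSum π (m + 2) ≤ 1 := hπ.2.2
  have h3 : partialSum π (m + 2) = 1 := by
    refine le_antisymm h2 ?_
    rw [hsum, heq] at h1
    nlinarith
  rw [h3, heq, mul_one, sub_self] at hsum
  have hz := (sum_eq_zero_iff_of_nonneg hnn).1 hsum
  have hd : ∀ j < m + 2, j ≠ 0 → j ≠ i → probDrop (m + 2) π j = 0 := by
    intro j hj hj0 hji
    refine (mul_eq_zero.1 (hz j (mem_range.2 hj))).resolve_left (ne_of_gt ?_)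
    rcases Nat.even_or_odd j with he | ho
    · exact reducedCost_pos_of_even h0 (h.mul_le_one hm) he hj0 hj
    · rcases (Nat.lt_succ_iff.1 hj).eq_or_lt with rfl | hlt'
      · exact reducedCost_add_one_pos hm (h.mul_le_one hm) ho
      · rw [reducedCost_of_odd θ ho]
        linarith [hlt j (by omega) ho hji]
  have hi0 : 0 ≠ i := hi.pos.ne
  have htwo : ∀ c : ℕ → ℝ, ∑ j ∈ range (m + 2), c j * probDrop (m + 2) π j =
      c 0 * probDrop (m + 2) π 0 + c i * probDrop (m + 2) π i := fun c =>
    sum_eq_add_of_mem 0 i (by simp) (by simp; omega) hi0 fun j hj hne => by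
      rw [hd j (mem_range.1 hj) hne.1 hne.2, mul_zero]
  have h4 := (budgetDefect_eq_zero_iff m π).1 hb
  rw [htwo fun j => (-1) ^ j * (m.choose j : ℝ), hi.neg_one_pow] at h4
  have h5 := sum_mul_probDrop (m + 2) π
  rw [h3, htwo fun j => (j : ℝ) + 1] at h5
  simp only [pow_zero, Nat.choose_zero_right, Nat.cast_one, Nat.cast_zero] at h4 h5
  have h6 : probDrop (m + 2) π 0 = m.choose i * probDrop (m + 2) π i := by linarith
  refine ⟨hd, h6, ?_⟩
  rw [eq_div_iff (by positivity)]
  linarith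

/-- The solution of the linear programme is unique if the minimal ratio is attained only once. -/
theorem IsRatioBound.partialSum_eq_of_eq {m : ℕ} {θ : ℝ} (hm : 1 ≤ m) (h0 : 0 ≤ θ)
    (h : IsRatioBound m θ) {i : ℕ} (hi : Odd i) (him : i ≤ m)
    (hlt : ∀ j ≤ m, Odd j → j ≠ i → θ * ((m.choose j : ℝ) + j + 1) < j)
    {π ρ : ℕ → ℝ} (hπ : IsRankProbabilities (m + 2) π) (hπb : budgetDefect (m + 2) π = 0)
    (hπ1 : π 1 = 1 - θ) (hρ : IsRankProbabilities (m + 2) ρ) (hρb : budgetDefect (m + 2) ρ = 0)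
    (hρ1 : ρ 1 = 1 - θ) {J : ℕ} (hJ : J ≤ m + 2) : partialSum π J = partialSum ρ J := by
  obtain ⟨a1, a2, a3⟩ := h.probDrop_of_eq hm h0 hi him hlt hπ hπb hπ1
  obtain ⟨b1, b2, b3⟩ := h.probDrop_of_eq hm h0 hi him hlt hρ hρb hρ1
  refine partialSum_eq_of_probDrop_eq (fun j hj => ?_) hJ
  by_cases hj0 : j = 0
  · rw [hj0, a2, b2, a3, b3]
  · by_cases hji : j = i
    · rw [hji, a3, b3]
    · rw [a1 j hj hj0 hji, b1 j hj hj0 hji]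

/-! ### The two-step probabilities -/

theorem twoStepProb_of_mem {n ℓ k : ℕ} (h : 2 ≤ k) (hk : k ≤ ℓ) :
    twoStepProb n ℓ k = 1 / (((n - 2).choose (ℓ - 1) : ℝ) + ℓ) := by
  rw [twoStepProb, if_neg (by omega), if_pos ⟨h, hk⟩]

theorem twoStepProb_of_lt {n ℓ k : ℕ} (h : 2 ≤ k) (hk : ℓ < k) : twoStepProb n ℓ k = 0 := by
  rw [twoStepProb, if_neg (by omega), if_neg (by omega)]

theorem partialSum_twoStepProb_of_le {n ℓ J : ℕ} (hJ : 1 ≤ J) (hJℓ : J ≤ ℓ) :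
    partialSum (twoStepProb n ℓ) J =
      1 - ((ℓ : ℝ) - J) / (((n - 2).choose (ℓ - 1) : ℝ) + ℓ) := by
  induction J, hJ using Nat.le_induction with
  | base => simp [partialSum_one, twoStepProb]
  | succ J hJ ih =>
    rw [partialSum_succ, ih (by omega), twoStepProb, if_neg (by omega), if_pos (by omega)]
    push_cast
    ring

theorem partialSum_twoStepProb_of_ge {n ℓ J : ℕ} (hℓ : 1 ≤ ℓ) (hJ : ℓ ≤ J) :
    partialSum (twoStepProb n ℓ) J = 1 := by
  induction J, hJ using Nat.le_induction with
  | base => rw [partialSum_twoStepProb_of_le hℓ le_rfl]; simp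
  | succ J hJ ih =>
    rw [partialSum_succ, ih, twoStepProb, if_neg (by omega), if_neg (by omega), add_zero]

theorem isRankProbabilities_twoStepProb {n ℓ : ℕ} (hℓ : 2 ≤ ℓ) (hℓn : ℓ ≤ n) :
    IsRankProbabilities n (twoStepProb n ℓ) := by
  have hD : (2 : ℝ) ≤ ((n - 2).choose (ℓ - 1) : ℝ) + ℓ := by
    have h1 : (2 : ℝ) ≤ ℓ := by exact_mod_cast hℓ
    have h2 : (0 : ℝ) ≤ ((n - 2).choose (ℓ - 1) : ℝ) := Nat.cast_nonneg _
    linarith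
  have hC : (0 : ℝ) ≤ ((n - 2).choose (ℓ - 1) : ℝ) := Nat.cast_nonneg _
  have hone : twoStepProb n ℓ 1 =
      (((n - 2).choose (ℓ - 1) : ℝ) + 1) / (((n - 2).choose (ℓ - 1) : ℝ) + ℓ) := by
    rw [twoStepProb, if_pos rfl]
    field_simp
    ring
  have hpos : 0 ≤ 1 / (((n - 2).choose (ℓ - 1) : ℝ) + ℓ) := by positivity
  have hle1 : 1 / (((n - 2).choose (ℓ - 1) : ℝ) + ℓ) ≤ twoStepProb n ℓ 1 := by
    rw [hone]
    gcongr
    linarith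
  have hnn : ∀ k, 0 ≤ twoStepProb n ℓ k := by
    intro k
    by_cases hk : k = 1
    · rw [hk]; exact hpos.trans hle1
    · rw [twoStepProb, if_neg hk]
      split_ifs
      exacts [hpos, le_rfl]
  have hle : ∀ k, k ≠ 1 → twoStepProb n ℓ k ≤ 1 / (((n - 2).choose (ℓ - 1) : ℝ) + ℓ) := by
    intro k hk
    rw [twoStepProb, if_neg hk]
    split_ifs
    exacts [le_rfl, hpos]
  have hsum := partialSum_twoStepProb_of_ge (n := n) (by omega : 1 ≤ ℓ) hℓn
  refine ⟨fun k hk => ⟨hnn k, ?_⟩, fun k hk l hl hkl => ?_, hsum.le⟩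
  · exact (single_le_sum (f := twoStepProb n ℓ) (fun j _ => hnn j) hk).trans hsum.le
  · rcases hkl.eq_or_lt with rfl | hkl
    · rfl
    rw [mem_Icc] at hk hl
    by_cases hk1 : k = 1
    · rw [hk1]
      exact (hle l (by omega)).trans hle1
    · rw [twoStepProb, twoStepProb, if_neg hk1, if_neg (by omega)]
      split_ifs with h1 h2
      · rfl
      · omega
      · exact hpos
      · rfl

/-- The only drops are at `0` and at the odd index `i = ℓ - 1`, in the ratio `choose m i : 1`, so
their signed contributions cancel. -/
theorem budgetDefect_twoStepProb {m ℓ : ℕ} (hℓ : 2 ≤ ℓ) (hℓn : ℓ ≤ m + 1) (he : Even ℓ) :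
    budgetDefect (m + 2) (twoStepProb (m + 2) ℓ) = 0 := by
  rw [budgetDefect_add_two]
  refine mul_eq_zero_of_right _ ?_
  obtain ⟨i, rfl⟩ : ∃ i, ℓ = i + 1 := ⟨ℓ - 1, by omega⟩
  have hi : Odd i := by
    rcases Nat.even_or_odd i with h | h
    · exact absurd he (Nat.not_even_iff_odd.2 h.add_one)
    · exact h
  have hD : (m.choose i : ℝ) + (i + 1) ≠ 0 := by positivity
  rw [sum_eq_add_of_mem 0 i (by simp) (by simp; omega) (by omega), hi.neg_one_pow]
  · rw [twoStepProb, twoStepProb, twoStepProb, twoStepProb, if_pos (by omega), if_neg (by omega),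
      if_pos (by omega), if_neg (by omega), if_pos (by omega), if_neg (by omega),
      if_neg (by omega)]
    simp only [Nat.add_sub_cancel, Nat.choose_zero_right]
    push_cast
    field_simp
    ring
  · intro j _ hj
    by_cases hj2 : j + 1 ≤ i
    · rw [twoStepProb_of_mem (by omega) (by omega), twoStepProb_of_mem (by omega) (by omega),
        sub_self, mul_zero]
    · rw [twoStepProb_of_lt (by omega) (by omega), twoStepProb_of_lt (by omega) (by omega),
        sub_self, mul_zero]

/-! ### The Green–Laffont rule -/

theorem highest_subset_of_isUpperAt {v : Profile n β} {U : Finset (Fin n)} (hU : IsUpperAt v U)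
    {k u : Fin n} (hu : u ∈ U) (huk : u ≠ k) : highest v (univ.erase k) ⊆ U := by
  intro x hx
  exact hU u hu x ((mem_filter.1 hx).2 u (by simpa using huk))

theorem highest_erase_map {v : Profile n β} {σ : Equiv.Perm (Fin n)} (h : ∀ i, v (σ i) = v i)
    (i k : Fin n) :
    i ∈ highest v (univ.erase k) ↔ σ i ∈ highest v (univ.erase (σ k)) := by
  simp only [highest, mem_filter, mem_erase, mem_univ, and_true, h, ne_eq,
    EmbeddingLike.apply_eq_iff_eq]
  refine and_congr_right fun _ => ⟨fun hi j hj => ?_, fun hi j hj => ?_⟩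
  · have := hi (σ.symm j) (fun h0 => hj (by rw [← h0, Equiv.apply_symm_apply]))
    rwa [← h (σ.symm j), Equiv.apply_symm_apply] at this
  · have := hi (σ j) (fun h0 => hj (σ.injective h0))
    rwa [h j] at this

/-- Swapping two tied agents preserves the profile and permutes the possible draws. -/
theorem isSymmetric_greenLaffont (n : ℕ) (β : ℝ) : IsSymmetric (greenLaffont n β) := by
  intro v i j hij
  have hσ : ∀ l, v (Equiv.swap i j l) = v l := by
    intro l
    rw [Equiv.swap_apply_def]
    split_ifs with h1 h2
    · rw [h1, hij]
    · rw [h2, hij]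
    · rfl
  have hcard : ∀ k, #(highest v (univ.erase (Equiv.swap i j k))) =
      #(highest v (univ.erase k)) := fun k =>
    (card_equiv (Equiv.swap i j) fun l => highest_erase_map hσ l k).symm
  rw [greenLaffont, ← Equiv.sum_comp (Equiv.swap i j)]
  rw [greenLaffont]
  congr 1
  refine sum_congr rfl fun k _ => ?_
  rw [hcard]
  refine if_congr ?_ rfl rfl
  rw [highest_erase_map hσ j k, Equiv.swap_apply_right]

theorem sum_ite_mem_highest (v : Profile n β) (U : Finset (Fin n)) (k : Fin n) :
    ∑ i ∈ U, (if i ∈ highest v (univ.erase k) then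
      1 / (#(highest v (univ.erase k)) : ℝ) else 0) =
    #(U ∩ highest v (univ.erase k)) / (#(highest v (univ.erase k)) : ℝ) := by
  rw [sum_ite_mem, sum_const, nsmul_eq_mul, mul_one_div]

theorem sum_ite_mem_highest_of_subset (hn : 2 ≤ n) {v : Profile n β} {U : Finset (Fin n)}
    {k : Fin n} (h : highest v (univ.erase k) ⊆ U) :
    ∑ i ∈ U, (if i ∈ highest v (univ.erase k) then
      1 / (#(highest v (univ.erase k)) : ℝ) else 0) = 1 := by
  rw [sum_ite_mem_highest, inter_eq_right.2 h]
  refine div_self (Nat.cast_ne_zero.2 (card_pos.2 (highest_nonempty v ?_)).ne')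
  rw [← card_pos, card_erase_of_mem (mem_univ k), card_univ, Fintype.card_fin]
  omega

theorem greenLaffontProb_eq (hn : 3 ≤ n) : greenLaffontProb n = twoStepProb n 2 := by
  funext k
  have h : (((n - 2).choose (2 - 1) : ℝ) + (2 : ℕ)) = n := by
    rw [Nat.choose_one_right, Nat.cast_sub (by omega)]
    ring
  rw [greenLaffontProb, twoStepProb, h]
  norm_num
  split_ifs <;> first | rfl | omega

theorem partialSum_greenLaffontProb (hn : 3 ≤ n) {J : ℕ} (hJ : 2 ≤ J) :
    partialSum (greenLaffontProb n) J = 1 := by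
  rw [greenLaffontProb_eq hn]
  exact partialSum_twoStepProb_of_ge (by omega) hJ

theorem greenLaffontProb_one (n : ℕ) : greenLaffontProb n 1 = 1 - 1 / (n : ℝ) := by
  simp [greenLaffontProb]

/-- An upper set with two or more members always keeps one after the draw, so the object goes to it
for certain. A single top agent receives the object unless drawn. -/
theorem sum_upper_greenLaffont (hn : 3 ≤ n) (v : Profile n β) (U : Finset (Fin n))
    (hU : IsUpperAt v U) :
    ∑ i ∈ U, greenLaffont n β v i = partialSum (greenLaffontProb n) #U := by
  have hn0 : (n : ℝ) ≠ 0 := by exact_mod_cast (by omega : n ≠ 0)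
  simp only [greenLaffont]
  rw [← mul_sum, sum_comm]
  rcases Nat.lt_or_ge #U 2 with hlt | hge
  · rcases U.eq_empty_or_nonempty with rfl | hne
    · simp [partialSum]
    obtain ⟨u, rfl⟩ := card_eq_one.1 (le_antisymm (Nat.lt_succ_iff.1 hlt) (card_pos.2 hne))
    have h1 : ∀ k, ∑ i ∈ {u}, (if i ∈ highest v (univ.erase k) then
        1 / (#(highest v (univ.erase k)) : ℝ) else 0) = 1 - if k = u then 1 else 0 := by
      intro k
      split_ifs with hk
      · subst hk; simp [highest]
      · rw [sum_ite_mem_highest_of_subset (by omega)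
          (highest_subset_of_isUpperAt hU (mem_singleton_self u) (Ne.symm hk)), sub_zero]
    rw [sum_congr rfl fun k _ => h1 k, card_singleton, partialSum_one, greenLaffontProb_one]
    simp
    field_simp
  · have h1 : ∀ k, ∑ i ∈ U, (if i ∈ highest v (univ.erase k) then
        1 / (#(highest v (univ.erase k)) : ℝ) else 0) = 1 := by
      intro k
      obtain ⟨u, hu, huk⟩ := exists_mem_ne hge k
      exact sum_ite_mem_highest_of_subset (by omega) (highest_subset_of_isUpperAt hU hu huk)
    rw [sum_congr rfl fun k _ => h1 k, partialSum_greenLaffontProb hn hge]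
    simp [hn0]

theorem isRankingRuleWith_greenLaffont (hn : 3 ≤ n) :
    IsRankingRuleWith (greenLaffont n β) (greenLaffontProb n) := by
  refine isRankingRuleWith_of_sum_upper ?_ (fun v i => ?_) (isSymmetric_greenLaffont n β)
    (sum_upper_greenLaffont hn)
  · rw [greenLaffontProb_eq hn]
    exact isRankProbabilities_twoStepProb le_rfl (by omega)
  · refine mul_nonneg (by positivity) (sum_nonneg fun k _ => ?_)
    split_ifs <;> positivity

theorem isSatisfactorilyImplementable_greenLaffont (hn : 3 ≤ n) :
    IsSatisfactorilyImplementable (greenLaffont n β) := by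
  refine (isRankingRuleWith_greenLaffont hn).isSatisfactorilyImplementable ?_
  rw [greenLaffontProb_eq hn]
  obtain ⟨m, rfl⟩ := Nat.exists_eq_add_of_le' (show 2 ≤ n by omega)
  exact budgetDefect_twoStepProb le_rfl (by omega) even_two

/-! ### Welfare comparison through partial sums -/

theorem IsRankingRuleWith.welfare_le {f g : Rule n β} {π ρ : ℕ → ℝ} (hf : IsRankingRuleWith f π)
    (hg : IsRankingRuleWith g ρ) (hβ : 0 < β) (h : ∀ J ≤ n, partialSum π J ≤ partialSum ρ J)
    (v : Profile n β) : welfare f v ≤ welfare g v := by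
  rw [hf.welfare_eq_integral, hg.welfare_eq_integral]
  exact intervalIntegral.integral_mono_on hβ.le (intervalIntegrable_comp_countGE v univ _ _ _)
    (intervalIntegrable_comp_countGE v univ _ _ _) fun t _ => h _ (countGE_le v univ t)

/-- These profiles detect each partial sum separately, which gives the converse of `welfare_le`. -/
theorem IsRankingRuleWith.welfare_extremeProfile {f : Rule n β} {π : ℕ → ℝ}
    (hf : IsRankingRuleWith f π) (hβ : 0 < β) (S : Finset (Fin n)) :
    welfare f (extremeProfile hβ S) = β * partialSum π #S := by
  have h : ∀ i, (extremeProfile hβ S i : ℝ) * f (extremeProfile hβ S) i =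
      if i ∈ S then β * f (extremeProfile hβ S) i else 0 := by
    intro i
    by_cases hi : i ∈ S <;> simp [extremeProfile, hi]
  rw [welfare, sum_congr rfl fun i _ => h i, sum_ite_mem, univ_inter, ← mul_sum,
    hf.sum_upper (isUpperAt_extremeProfile hβ S)]

theorem exists_card_eq {J : ℕ} (hJ : J ≤ n) : ∃ S : Finset (Fin n), #S = J := by
  obtain ⟨S, -, hS⟩ := exists_subset_card_eq (s := (univ : Finset (Fin n))) (n := J) (by simpa)
  exact ⟨S, hS⟩

theorem IsRankingRuleWith.partialSum_le {f g : Rule n β} {π ρ : ℕ → ℝ}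
    (hf : IsRankingRuleWith f π) (hg : IsRankingRuleWith g ρ) (hβ : 0 < β)
    (h : ∀ v, welfare f v ≤ welfare g v) {J : ℕ} (hJ : J ≤ n) :
    partialSum π J ≤ partialSum ρ J := by
  obtain ⟨S, rfl⟩ := exists_card_eq hJ
  have := h (extremeProfile hβ S)
  rw [hf.welfare_extremeProfile, hg.welfare_extremeProfile] at this
  exact le_of_mul_le_mul_left this hβ

/-- A rule that is r-Pareto optimal is not dominated in terms of partial sums. -/
theorem IsRParetoOptimal.eq_of_partialSum_le {f g : Rule n β} {π ρ : ℕ → ℝ}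
    (hf : IsRankingRuleWith f π) (hg : IsRankingRuleWith g ρ) (hβ : 0 < β)
    (hgi : IsSatisfactorilyImplementable g) (hopt : IsRParetoOptimal f)
    (h : ∀ J ≤ n, partialSum π J ≤ partialSum ρ J) : f = g := by
  refine hf.eq_of_partialSum_eq hg fun J hJ => le_antisymm (h J hJ) (not_lt.1 fun hlt => ?_)
  obtain ⟨S, rfl⟩ := exists_card_eq hJ
  refine hopt.2.2 ⟨g, ⟨ρ, hg⟩, hgi, hf.welfare_le hg hβ h, extremeProfile hβ S, ?_⟩
  rw [hf.welfare_extremeProfile, hg.welfare_extremeProfile]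
  exact mul_lt_mul_of_pos_left hlt hβ

theorem IsRankingRuleWith.partialSum_le_one {f : Rule n β} {π : ℕ → ℝ}
    (hf : IsRankingRuleWith f π) {J : ℕ} (hJ : J ≤ n) : partialSum π J ≤ 1 := by
  refine le_trans ?_ hf.2.2.1.2.2
  exact sum_le_sum_of_subset_of_nonneg (Icc_subset_Icc_right hJ)
    fun m hm _ => (hf.2.2.1.1 m hm).1

theorem IsRankingRuleWith.partialSum_le_greenLaffont {f : Rule n β} {π : ℕ → ℝ} (hn : 3 ≤ n)
    (hf : IsRankingRuleWith f π) (h1 : π 1 ≤ 1 - 1 / (n : ℝ)) {J : ℕ} (hJ : J ≤ n) :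
    partialSum π J ≤ partialSum (greenLaffontProb n) J := by
  rcases Nat.lt_or_ge J 2 with hlt | hge
  · interval_cases J
    · simp [partialSum_zero]
    · rwa [partialSum_one, partialSum_one, greenLaffontProb_one]
  · rw [partialSum_greenLaffontProb hn hge]
    exact hf.partialSum_le_one hJ

/-! ### Optimal ratios and the three claims -/

theorem isRatioBound_of_le_eight (hn : 3 ≤ n) (hn8 : n ≤ 8) :
    IsRatioBound (n - 2) (1 / (n : ℝ)) := by
  intro j hj ho
  rw [one_div, inv_mul_le_iff₀ (by positivity)]
  have : (n - 2).choose j + j + 1 ≤ n * j := by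
    interval_cases n <;> interval_cases j <;>
      first | decide | (exact absurd ho (by decide))
  exact_mod_cast this

theorem IsOptimalStep.exists_odd {m ℓ : ℕ} (h : IsOptimalStep (m + 2) ℓ) :
    ∃ i, ℓ = i + 1 ∧ Odd i ∧ i ≤ m ∧
      IsRatioBound m ((i : ℝ) / ((m.choose i : ℝ) + i + 1)) := by
  obtain ⟨⟨h2, hle, he⟩, hmin⟩ := h
  obtain ⟨i, rfl⟩ : ∃ i, ℓ = i + 1 := ⟨ℓ - 1, by omega⟩
  refine ⟨i, rfl, ?_, by omega, fun j hj ho => ?_⟩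
  · rcases Nat.even_or_odd i with h | h
    · exact absurd he (Nat.not_even_iff_odd.2 h.add_one)
    · exact h
  · have h1 := hmin (j + 1) (by have := ho.pos; omega) (by omega) ho.add_one
    simp only [Nat.add_sub_cancel] at h1
    push_cast at h1
    rw [add_sub_cancel_right, add_sub_cancel_right, ← add_assoc, ← add_assoc] at h1
    rwa [le_div_iff₀ (by positivity)] at h1

theorem IsRatioBound.lt_of_ne {m i : ℕ} (hm : 7 ≤ m) (hi : Odd i) (him : i ≤ m)
    (h : IsRatioBound m ((i : ℝ) / ((m.choose i : ℝ) + i + 1))) {j : ℕ} (hj : j ≤ m) (ho : Odd j)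
    (hne : j ≠ i) : (i : ℝ) / ((m.choose i : ℝ) + i + 1) * ((m.choose j : ℝ) + j + 1) < j := by
  have hmax : ∀ k ≤ m, Odd k → (m.choose k + 1) * i ≤ (m.choose i + 1) * k := by
    intro k hk hko
    have h1 := h k hk hko
    rw [div_mul_eq_mul_div, div_le_iff₀ (by positivity)] at h1
    have h2 : i * (m.choose k + k + 1) ≤ k * (m.choose i + i + 1) := by exact_mod_cast h1
    -- The common term `i * k` cancels, so minimal ratio means maximal `(choose m i + 1) / i`.
    nlinarith
  have h3 := maximizer_unique hm hi him hmax ho hj hne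
  rw [div_mul_eq_mul_div, div_lt_iff₀ (by positivity)]
  have h4 : i * (m.choose j + j + 1) < j * (m.choose i + i + 1) := by nlinarith
  exact_mod_cast h4

theorem twoStepProb_one (m i : ℕ) :
    twoStepProb (m + 2) (i + 1) 1 = 1 - (i : ℝ) / ((m.choose i : ℝ) + i + 1) := by
  rw [twoStepProb, if_pos rfl]
  simp only [Nat.add_sub_cancel]
  push_cast
  rw [add_sub_cancel_right, add_assoc]

theorem isRParetoOptimal_iff_of_le_eight (hn : 3 ≤ n) (hn8 : n ≤ 8) (hβ : 0 < β) (f : Rule n β) :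
    IsRParetoOptimal f ↔ f = greenLaffont n β := by
  have hGL := isRankingRuleWith_greenLaffont (β := β) hn
  have hGLi := isSatisfactorilyImplementable_greenLaffont (β := β) hn
  have hle : ∀ (g : Rule n β) (ρ : ℕ → ℝ), IsRankingRuleWith g ρ →
      IsSatisfactorilyImplementable g → ρ 1 ≤ 1 - 1 / (n : ℝ) := by
    intro g ρ hg hgi
    have hb := isRatioBound_of_le_eight hn hn8
    have h0 := hg.budgetDefect_eq_zero hβ hgi
    have h1 := hg.2.2.1
    have hm : n - 2 + 2 = n := by omega
    exact hb.prob_one_le (by omega) (by positivity) (by rwa [hm]) (by rwa [hm])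
  constructor
  · intro hf
    obtain ⟨π, hπ⟩ := hf.1
    exact IsRParetoOptimal.eq_of_partialSum_le hπ hGL hβ hGLi hf fun J hJ =>
      hπ.partialSum_le_greenLaffont hn (hle f π hπ hf.2.1) hJ
  · rintro rfl
    refine ⟨⟨_, hGL⟩, hGLi, ?_⟩
    rintro ⟨g, ⟨ρ, hg⟩, hgi, -, v, hlt⟩
    exact hlt.not_ge (hg.welfare_le hGL hβ
      (fun J hJ => hg.partialSum_le_greenLaffont hn (hle g ρ hg hgi) hJ) v)

theorem IsRankingRuleWith.prob_one_le_twoStepProb {ℓ : ℕ} (hn : 3 ≤ n) (hβ : 0 < β)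
    (hℓ : IsOptimalStep n ℓ) {g : Rule n β} {ρ : ℕ → ℝ} (hg : IsRankingRuleWith g ρ)
    (hgi : IsSatisfactorilyImplementable g) : ρ 1 ≤ twoStepProb n ℓ 1 := by
  obtain ⟨m, rfl⟩ := Nat.exists_eq_add_of_le' (show 2 ≤ n by omega)
  obtain ⟨i, rfl, -, -, hb⟩ := hℓ.exists_odd
  rw [twoStepProb_one]
  exact hb.prob_one_le (by omega) (by positivity) hg.2.2.1 (hg.budgetDefect_eq_zero hβ hgi)

theorem IsRankingRuleWith.eq_of_prob_one_eq {ℓ : ℕ} (hn : 8 < n) (hβ : 0 < β)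
    (hℓ : IsOptimalStep n ℓ) {f g : Rule n β} {π ρ : ℕ → ℝ} (hf : IsRankingRuleWith f π)
    (hfi : IsSatisfactorilyImplementable f) (hπ : π 1 = twoStepProb n ℓ 1)
    (hg : IsRankingRuleWith g ρ) (hgi : IsSatisfactorilyImplementable g)
    (hρ : ρ 1 = twoStepProb n ℓ 1) : f = g := by
  obtain ⟨m, rfl⟩ := Nat.exists_eq_add_of_le' (show 2 ≤ n by omega)
  obtain ⟨i, rfl, hi, him, hb⟩ := hℓ.exists_odd
  rw [twoStepProb_one] at hπ hρ
  refine hf.eq_of_partialSum_eq hg fun J hJ => ?_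
  exact hb.partialSum_eq_of_eq (by omega) (by positivity) hi him
    (fun j hj ho hne => hb.lt_of_ne (by omega) hi him hj ho hne)
    hf.2.2.1 (hf.budgetDefect_eq_zero hβ hfi) hπ hg.2.2.1 (hg.budgetDefect_eq_zero hβ hgi) hρ hJ

theorem exists_isROptimal_twoStep {ℓ : ℕ} (hn : 8 < n) (hβ : 0 < β) (hℓ : IsOptimalStep n ℓ) :
    ∃ f : Rule n β, IsRankingRuleWith f (twoStepProb n ℓ) ∧
      (∀ g : Rule n β, IsROptimal g ↔ g = f) ∧ IsRParetoOptimal f := by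
  have hf := isRankingRuleWith_tieAverage (β := β)
    (isRankProbabilities_twoStepProb hℓ.1.1 (by have := hℓ.1.2.1; omega : ℓ ≤ n))
  have hfi : IsSatisfactorilyImplementable (tieAverage n β (twoStepProb n ℓ)) := by
    refine hf.isSatisfactorilyImplementable ?_
    obtain ⟨m, rfl⟩ := Nat.exists_eq_add_of_le' (show 2 ≤ n by omega)
    exact budgetDefect_twoStepProb hℓ.1.1 (by have := hℓ.1.2.1; omega) hℓ.1.2.2
  refine ⟨_, hf, fun g => ⟨?_, ?_⟩, ⟨_, hf⟩, hfi, ?_⟩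
  · rintro ⟨ρ, hg, hgi, hmax⟩
    exact hg.eq_of_prob_one_eq hn hβ hℓ hgi
      (le_antisymm (hg.prob_one_le_twoStepProb (by omega) hβ hℓ hgi) (hmax _ _ hf hfi)) hf hfi rfl
  · rintro rfl
    exact ⟨_, hf, hfi, fun h ρ hh hhi => hh.prob_one_le_twoStepProb (by omega) hβ hℓ hhi⟩
  · rintro ⟨g, ⟨ρ, hg⟩, hgi, hle, v, hlt⟩
    -- A dominating rule has at least the same top probability, hence is r-optimal too and coincides
    -- with `f`.
    have h1 := hf.partialSum_le hg hβ hle (J := 1) (by omega)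
    rw [partialSum_one, partialSum_one] at h1
    have h2 := hg.eq_of_prob_one_eq hn hβ hℓ hgi
      (le_antisymm (hg.prob_one_le_twoStepProb (by omega) hβ hℓ hgi) h1) hf hfi rfl
    rw [h2] at hlt
    exact hlt.false

theorem IsRParetoOptimal.le_prob_one (hn : 3 ≤ n) (hβ : 0 < β) {f : Rule n β} {π : ℕ → ℝ}
    (hf : IsRankingRuleWith f π) (hopt : IsRParetoOptimal f) : 1 - 1 / (n : ℝ) ≤ π 1 := by
  by_contra hlt
  rw [not_le] at hlt
  have hGL := isRankingRuleWith_greenLaffont (β := β) hn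
  have h := IsRParetoOptimal.eq_of_partialSum_le hf hGL hβ
    (isSatisfactorilyImplementable_greenLaffont hn) hopt fun J hJ =>
      hf.partialSum_le_greenLaffont hn hlt.le hJ
  subst h
  -- Here `f` is the Green–Laffont rule; comparing it with itself under its two probability
  -- sequences recovers the value of `π 1`.
  have h1 := hGL.partialSum_le hf hβ (fun _ => le_rfl) (J := 1) (by omega)
  rw [partialSum_one, partialSum_one, greenLaffontProb_one] at h1
  exact hlt.not_ge h1

end RankingMechanism

theorem mainTheorem6 (n : ℕ) (hn : 3 ≤ n) (β : ℝ) (hβ : 0 < β) :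
    (n ≤ 8 →
      RankingMechanism.IsRankingRuleWith (RankingMechanism.greenLaffont n β)
        (RankingMechanism.greenLaffontProb n) ∧
      ∀ f : RankingMechanism.Rule n β,
        RankingMechanism.IsRParetoOptimal f ↔ f = RankingMechanism.greenLaffont n β) ∧
    (8 < n → ∀ ℓ : ℕ, RankingMechanism.IsOptimalStep n ℓ →
      ∃ f : RankingMechanism.Rule n β,
        RankingMechanism.IsRankingRuleWith f (RankingMechanism.twoStepProb n ℓ) ∧
        (∀ g : RankingMechanism.Rule n β, RankingMechanism.IsROptimal g ↔ g = f) ∧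
        RankingMechanism.IsRParetoOptimal f) ∧
    (∀ (f : RankingMechanism.Rule n β) (π : ℕ → ℝ),
      RankingMechanism.IsRankingRuleWith f π → RankingMechanism.IsRParetoOptimal f →
      ∀ ℓ : ℕ, RankingMechanism.IsOptimalStep n ℓ →
        1 - 1 / (n : ℝ) ≤ π 1 ∧ π 1 ≤ RankingMechanism.twoStepProb n ℓ 1) := by
  refine ⟨fun hn8 => ⟨RankingMechanism.isRankingRuleWith_greenLaffont hn,
    RankingMechanism.isRParetoOptimal_iff_of_le_eight hn hn8 hβ⟩,
    fun hn8 ℓ hℓ => RankingMechanism.exists_isROptimal_twoStep hn8 hβ hℓ,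
    fun f π hf hopt ℓ hℓ => ⟨hopt.le_prob_one hn hβ hf,
      hf.prob_one_le_twoStepProb hn hβ hℓ hopt.2.1⟩⟩
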